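/- Let $\theta\in(0,\pi/2)$ be fixed. Let $S_{d-1}$ be the unit sphere of $\mathbb{R}^d$, let $s$ be its surface area measure normalized to total mass $1$, and let $s_d(\theta)=s(\{y\in S_{d-1}:\langle x,y\rangle\ge\cos\theta\})$ be the normalized surface area of a spherical cap of angular radius $\theta$ (it does not depend on $x\in S_{d-1}$). Put $$q(\theta)=\arcsin\left(\frac{\sqrt{(\cos\theta-1)^2(1+2\cos\theta)}}{\sin\theta}\right),\qquad c_\theta=\log\frac{\sin\theta}{\sin q(\theta)}.$$ Let $\mathbb{P}[E_{d,\theta,n}]$ be the probability that $n$ independent uniformly distributed points $x_1,\dots,x_n$ of $S_{d-1}$ form a spherical code of angle $\theta$, that is, satisfy $\langle x_i,x_j\rangle\le\cos\theta$ for all $i\ne j$. Then there exists a sequence of integers $n=n(d)$ with $$n\ \ge\ (1+o(1))\,\frac{c_\theta\cdot d}{s_d(\theta)}$$ such that, for all sufficiently large $d$, $\mathbb{P}[E_{d,\theta,n}]>0$, and $$\frac1n\log\left(\frac{\mathbb{P}[E_{d,\theta,n}]}{n!}\right)\ \ge\ \log s_d(q(\theta))+o(1)$$ as $d\to\infty$,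 where the $o(1)$ terms may depend on $\theta$. -/

import Mathlib

namespace SphericalCode

/-- The unit sphere `S_{d-1}` of `ℝ^d`. -/
abbrev Sph (d : ℕ) : Type := Metric.sphere (0 : EuclideanSpace ℝ (Fin d)) 1

/-- Normalized surface area `s` on `S_{d-1}`: the surface measure divided by its total mass. -/
noncomputable def surf (d : ℕ) : MeasureTheory.Measure (Sph d) :=
  ((MeasureTheory.volume : MeasureTheory.Measure (EuclideanSpace ℝ (Fin d))).toSphere
      Set.univ)⁻¹ •
    (MeasureTheory.volume : MeasureTheory.Measure (EuclideanSpace ℝ (Fin d))).toSphere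

/-- The spherical cap `C_θ(x)` of angular radius `θ` around `x`. -/
def cap {d : ℕ} (θ : ℝ) (x : Sph d) : Set (Sph d) :=
  {y | Real.cos θ ≤ inner ℝ (x : EuclideanSpace ℝ (Fin d)) (y : EuclideanSpace ℝ (Fin d))}

/-- `s_d(θ)`: the normalized surface area of a spherical cap of angular radius `θ`. The area does
not depend on the center (`capArea_eq`), so the supremum is over a constant family. -/
noncomputable def capArea (d : ℕ) (θ : ℝ) : ℝ := ⨆ x : Sph d, (surf d).real (cap θ x)

/-- `q(θ)`: the angular radius of the smallest spherical cap that contains the intersection of two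
caps of angular radius `θ` whose centers are at angle `θ`. -/
noncomputable def q (θ : ℝ) : ℝ :=
  Real.arcsin (√((Real.cos θ - 1) ^ 2 * (1 + 2 * Real.cos θ)) / Real.sin θ)

/-- The constant `c_θ`. -/
noncomputable def c (θ : ℝ) : ℝ := Real.log (Real.sin θ / Real.sin (q θ))

/-- The points `x_1, …, x_n` form a spherical code of angle `θ`. -/
def IsCode {d n : ℕ} (θ : ℝ) (x : Fin n → Sph d) : Prop :=
  ∀ i j : Fin n, i ≠ j →
    inner ℝ (x i : EuclideanSpace ℝ (Fin d)) (x j : EuclideanSpace ℝ (Fin d)) ≤ Real.cos θ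

/-- `P[E_{d,θ,n}]`: the probability that `n` independent uniform points of `S_{d-1}` form a
spherical code of angle `θ`. -/
noncomputable def codeProb (d : ℕ) (θ : ℝ) (n : ℕ) : ℝ :=
  (MeasureTheory.Measure.pi (fun _ : Fin n => surf d)).real {x | IsCode θ x}

theorem isProbabilityMeasure_surf (d : ℕ) [NeZero d] :
    MeasureTheory.IsProbabilityMeasure (surf d) := by
  have : Nonempty (Fin d) := ⟨0⟩
  constructor
  simp only [surf, MeasureTheory.Measure.smul_apply, smul_eq_mul]
  apply ENNReal.inv_mul_cancel
  · exact (MeasureTheory.Measure.measure_univ_ne_zero).2 (MeasureTheory.Measure.toSphere_ne_zero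
      (MeasureTheory.volume : MeasureTheory.Measure (EuclideanSpace ℝ (Fin d))))
  · exact MeasureTheory.measure_ne_top _ _

theorem measurableSet_cap {d : ℕ} (θ : ℝ) (x : Sph d) : MeasurableSet (cap θ x) := by
  apply IsClosed.measurableSet
  exact isClosed_le continuous_const (by fun_prop)

open scoped Pointwise in
theorem surf_cap_eq {d : ℕ} (θ : ℝ) (x y : Sph d) : surf d (cap θ x) = surf d (cap θ y) := by
  have hxy : ‖(x : EuclideanSpace ℝ (Fin d))‖ = ‖(y : EuclideanSpace ℝ (Fin d))‖ := by simp
  obtain ⟨e, he⟩ : ∃ e : EuclideanSpace ℝ (Fin d) ≃ₗᵢ[ℝ] EuclideanSpace ℝ (Fin d), e x = y :=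
    ⟨_, Submodule.reflection_sub hxy⟩
  have h : Set.Ioo (0 : ℝ) 1 • ((↑) '' cap θ x : Set (EuclideanSpace ℝ (Fin d)))
      = e ⁻¹' (Set.Ioo (0 : ℝ) 1 • ((↑) '' cap θ y : Set (EuclideanSpace ℝ (Fin d)))) := by
    ext v
    simp only [Set.mem_smul, Set.mem_preimage, Set.mem_image]
    constructor
    · rintro ⟨r, hr, _, ⟨z, hz, rfl⟩, rfl⟩
      refine ⟨r, hr, e z, ⟨⟨e z, by simp⟩, ?_, rfl⟩, by simp⟩
      simpa [cap, ← he] using hz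
    · rintro ⟨r, hr, _, ⟨z, hz, rfl⟩, hv⟩
      refine ⟨r, hr, e.symm z, ⟨⟨e.symm z, by simp⟩, ?_, rfl⟩, ?_⟩
      · have h2 := e.inner_map_map (x : EuclideanSpace ℝ (Fin d)) (e.symm z)
        simp only [LinearIsometryEquiv.apply_symm_apply, he] at h2
        simpa [cap, ← h2] using hz
      · apply e.injective
        simpa using hv
  simp only [surf, MeasureTheory.Measure.smul_apply]
  rw [MeasureTheory.Measure.toSphere_apply' _ (measurableSet_cap θ x),
    MeasureTheory.Measure.toSphere_apply' _ (measurableSet_cap θ y), h]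
  congr 2
  exact e.measurePreserving.measure_preimage_equiv (f := e.toMeasurableEquiv) _

/-- `s_d(θ) = s(C_θ(x))` for every `x`. -/
theorem capArea_eq {d : ℕ} (θ : ℝ) (x : Sph d) : capArea d θ = (surf d).real (cap θ x) := by
  have : Nonempty (Sph d) := ⟨x⟩
  have h : ∀ y : Sph d, (surf d).real (cap θ y) = (surf d).real (cap θ x) := fun y => by
    simp only [MeasureTheory.Measure.real, surf_cap_eq θ y x]
  simp only [capArea, h, ciSup_const]

end SphericalCode

/-! The proof studies the hard-core model: a random code `X` whose `k`-point configurations carry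
weight `l ^ k / k!`, with partition function `Z` and unnormalized mean size `Y`, so that `E|X| = Y /
Z`. A lower bound on `E|X|` yields both a large code size and a lower bound on its probability.

Fix a point `x` and let `N` be the set of points in conflict with it. Given the part of `X` outside
`N`, the part inside is again a hard-core model, on the subset `T` of `N` that is still free. If the
conflict pairs in `T` are so few that their mass times `l` is at most `κ * μ T`, then `l * μ T ≤ E|X
∩ T| / (1 - κ)` (`mul_part_le`). Also `log Z_T ≤ l * μ T` (`part_le_exp`), and `T` is empty of
points with probability `1 / Z_T`. Since `log t ≤ t - 1` at `t = b / Z_T`, this gives `1 + log b ≤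
E|X ∩ T| / (1 - κ) + b / Z_T` (`log_mul_part_le`). Averaging over `x`, the expected number of points
in `N` is at most `s * E|X|`, while the probability that `N` is empty averages to `E|X| / l`; this
is `log_mul_part_le_points`.

The geometric input is `exists_cap_q`: in a cap of radius `θ`, a point `u` has its conflicts that
are at least as close to the centre as itself inside one cap of radius `q θ`. With `σ = s_d(q θ)`,
the choices `l = 1 / (d * σ)`, `κ = 2 / d` and `b = s / (d ^ 2 * σ)` give `E|X| ≥ (1 + o(1)) * log
(s / σ) / s`. Volume bounds for cones over caps show `log (s / σ) ~ c θ * d`. Finally, codes have at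
most exponentially many points, so pigeonhole (`exists_large_term`) finds one size `n` near or above
the mean whose term in `Z` is not too small. Dividing that term by `l ^ n` gives the probability
bound. -/

open MeasureTheory Set
open scoped ENNReal NNReal

/-! ### Measures of pairwise compatible configurations -/

namespace HardCore

variable {S : Type*}

/-- Families of points that are pairwise compatible for the relation `R`. -/
def codeSet (R : S → S → Prop) (ι : Type*) : Set (ι → S) :=
  {x | ∀ i j, i ≠ j → R (x i) (x j)}

theorem codeSet_comp_mem {R : S → S → Prop} {ι κ : Type*} {x : ι → S} (hx : x ∈ codeSet R ι)
    {f : κ → ι} (hf : Function.Injective f) : x ∘ f ∈ codeSet R κ :=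
  fun _ _ hij => hx _ _ (hf.ne hij)

theorem mem_codeSet_comp_equiv {R : S → S → Prop} {ι κ : Type*} {x : ι → S} (e : κ ≃ ι) :
    x ∘ e ∈ codeSet R κ ↔ x ∈ codeSet R ι := by
  refine ⟨fun h => ?_, fun h => codeSet_comp_mem h e.injective⟩
  simpa [Function.comp_assoc] using codeSet_comp_mem h e.symm.injective

theorem cons_mem_codeSet {R : S → S → Prop} (hR : ∀ u v, R u v → R v u) {k : ℕ} (u : S)
    (y : Fin k → S) :
    (Fin.cons u y : Fin (k + 1) → S) ∈ codeSet R (Fin (k + 1)) ↔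
      y ∈ codeSet R (Fin k) ∧ ∀ i, R u (y i) := by
  constructor
  · intro h
    refine ⟨codeSet_comp_mem h (Fin.succ_injective k), fun i => ?_⟩
    simpa using h 0 i.succ (Fin.succ_ne_zero i).symm
  · rintro ⟨h, h'⟩ i j hij
    refine Fin.cases (fun hj => ?_) (fun i hj => ?_) i hij <;>
      revert hj <;> refine Fin.cases ?_ (fun j => ?_) j
    · simp
    · exact fun _ => by simpa using h' j
    · simpa using hR _ _ (h' i)
    · intro hj
      simpa using h i j (by simpa using hj)

theorem elim_mem_codeSet {R : S → S → Prop} (hR : ∀ u v, R u v → R v u) {ι κ : Type*}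
    (y : ι → S) (z : κ → S) :
    Sum.elim y z ∈ codeSet R (ι ⊕ κ) ↔
      y ∈ codeSet R ι ∧ z ∈ codeSet R κ ∧ ∀ i j, R (y i) (z j) := by
  constructor
  · intro h
    exact ⟨codeSet_comp_mem h Sum.inl_injective, codeSet_comp_mem h Sum.inr_injective,
      fun i j => h (.inl i) (.inr j) (by simp)⟩
  · rintro ⟨h1, h2, h3⟩ (i | i) (j | j) hij
    · exact h1 i j (by simpa using hij)
    · exact h3 i j
    · exact hR _ _ (h3 j i)
    · exact h2 i j (by simpa using hij)

variable [MeasurableSpace S]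

theorem measurableSet_codeSet {R : S → S → Prop} (hR : MeasurableSet {p : S × S | R p.1 p.2})
    (ι : Type*) [Countable ι] : MeasurableSet (codeSet R ι) := by
  simp only [codeSet, ofPred_forall]
  refine .iInter fun i => .iInter fun j => .iInter fun _ => ?_
  exact hR.preimage (f := fun x : ι → S => (x i, x j)) (by fun_prop)

/-- The measure of the set of codes of size `k`. -/
noncomputable def codeMeas (μ : Measure S) (R : S → S → Prop) (k : ℕ) : ℝ≥0∞ :=
  Measure.pi (fun _ : Fin k => μ) (codeSet R (Fin k))

theorem pi_succ (μ : Measure S) [SigmaFinite μ] {k : ℕ} (i : Fin (k + 1))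
    (A : Set (Fin (k + 1) → S)) :
    Measure.pi (fun _ : Fin (k + 1) => μ) A =
      (μ.prod (Measure.pi fun _ : Fin k => μ)) {p | i.insertNth p.1 p.2 ∈ A} :=
  ((measurePreserving_piFinSuccAbove (fun _ : Fin (k + 1) => μ) i).symm.measure_preimage_equiv
    A).symm

theorem codeMeas_succ (μ : Measure S) [SigmaFinite μ] {R : S → S → Prop}
    (hs : ∀ u v, R u v → R v u) (k : ℕ) :
    codeMeas μ R (k + 1) = (μ.prod (Measure.pi fun _ : Fin k => μ))
      {p | p.2 ∈ codeSet R (Fin k) ∧ ∀ i, R p.1 (p.2 i)} := by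
  rw [codeMeas, pi_succ μ 0]
  congr 1
  ext p
  simp [Fin.insertNth_zero', cons_mem_codeSet hs]

theorem codeMeas_zero (μ : Measure S) (R : S → S → Prop) : codeMeas μ R 0 = 1 := by
  have : codeSet R (Fin 0) = univ := eq_univ_of_forall fun x i => i.elim0
  simp [codeMeas, this]

theorem codeMeas_le (μ : Measure S) [SigmaFinite μ] (R : S → S → Prop) (k : ℕ) :
    codeMeas μ R k ≤ μ univ ^ k := by
  refine (measure_mono (subset_univ _)).trans ?_
  simp [Measure.pi_univ]

/-- Add a free point to a code of size `k`: either the result is a code, or the new point conflicts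
with one of the `k` old ones. In the second case, forget every constraint on that old point except
this conflict; the other points still form a code. For `k = 0` the truncated `k - 1` is harmless
because of the factor `k`. -/
theorem mul_codeMeas_le (μ : Measure S) [SigmaFinite μ] {R : S → S → Prop}
    (hR : MeasurableSet {p : S × S | R p.1 p.2}) (hs : ∀ u v, R u v → R v u) (k : ℕ) :
    μ univ * codeMeas μ R k ≤ codeMeas μ R (k + 1) +
      k * ((μ.prod μ) {p | ¬ R p.1 p.2} * codeMeas μ R (k - 1)) := by
  have hconf (i : Fin k) : (μ.prod (Measure.pi fun _ : Fin k => μ))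
      {p | ¬ R p.1 (p.2 i) ∧ p.2 ∈ codeSet R (Fin k)} ≤
        (μ.prod μ) {p | ¬ R p.1 p.2} * codeMeas μ R (k - 1) := by
    obtain _ | k := k
    · exact i.elim0
    have hm : MeasurableSet {p : S × (Fin (k + 1) → S) |
        ¬ R p.1 (p.2 i) ∧ p.2 ∈ codeSet R (Fin (k + 1))} := by
      refine .inter ?_ ((measurableSet_codeSet hR _).preimage measurable_snd)
      exact hR.compl.preimage (f := fun p : S × (Fin (k + 1) → S) => (p.1, p.2 i)) (by fun_prop)
    have hRc : MeasurableSet {p : S × S | ¬ R p.1 p.2} := hR.compl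
    rw [Measure.prod_apply hm, Measure.prod_apply hRc,
      ← lintegral_mul_const _ (measurable_measure_prodMk_left hRc)]
    refine lintegral_mono fun u => ?_
    rw [pi_succ μ i, Nat.add_sub_cancel, codeMeas, ← Measure.prod_prod]
    refine measure_mono fun p hp => ?_
    simp only [mem_ofPred_eq, mem_preimage, Fin.insertNth_apply_same] at hp
    refine ⟨hp.1, ?_⟩
    have := codeSet_comp_mem hp.2 (Fin.succAbove_right_injective (p := i))
    convert this using 1
    ext j
    simp
  rw [codeMeas_succ μ hs, codeMeas, ← Measure.prod_prod]
  calc _ ≤ (μ.prod (Measure.pi fun _ : Fin k => μ))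
        ({p | p.2 ∈ codeSet R (Fin k) ∧ ∀ i, R p.1 (p.2 i)} ∪
          ⋃ i : Fin k, {p | ¬ R p.1 (p.2 i) ∧ p.2 ∈ codeSet R (Fin k)}) := by
        refine measure_mono fun p hp => ?_
        by_cases h : ∀ i, R p.1 (p.2 i)
        · exact .inl ⟨hp.2, h⟩
        · push Not at h
          obtain ⟨i, hi⟩ := h
          exact .inr (mem_iUnion.2 ⟨i, hi, hp.2⟩)
    _ ≤ _ := by
        refine (measure_union_le _ _).trans (add_le_add le_rfl ?_)
        refine (measure_iUnion_le _).trans ?_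
        rw [tsum_fintype]
        refine (Finset.sum_le_sum fun i _ => hconf i).trans ?_
        simp

/-! ### Partition function and mean number of points -/

/-- The activity `l ^ k / k!` of a configuration of `k` points. -/
noncomputable def weight (l : ℝ≥0) (k : ℕ) : ℝ≥0∞ := ((l ^ k / k.factorial : ℝ≥0) : ℝ≥0∞)

theorem weight_zero (l : ℝ≥0) : weight l 0 = 1 := by simp [weight]

theorem weight_ne_top (l : ℝ≥0) (k : ℕ) : weight l k ≠ ∞ := ENNReal.coe_ne_top

theorem succ_mul_weight (l : ℝ≥0) (k : ℕ) :
    ((k + 1 : ℕ) : ℝ≥0∞) * weight l (k + 1) = l * weight l k := by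
  simp only [weight]
  norm_cast
  rw [Nat.factorial_succ]
  push_cast
  have : (k.factorial : ℝ≥0) ≠ 0 := by exact_mod_cast k.factorial_ne_zero
  field_simp
  ring

theorem weight_mul_choose (l : ℝ≥0) (j m : ℕ) :
    weight l (j + m) * ((j + m).choose m : ℝ≥0∞) = weight l j * weight l m := by
  simp only [weight]
  norm_cast
  have h := Nat.add_choose_mul_factorial_mul_factorial j m
  have h1 : (j.factorial : ℝ≥0) ≠ 0 := by exact_mod_cast j.factorial_ne_zero
  have h2 : (m.factorial : ℝ≥0) ≠ 0 := by exact_mod_cast m.factorial_ne_zero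
  have h3 : ((j + m).factorial : ℝ≥0) ≠ 0 := by exact_mod_cast (j + m).factorial_ne_zero
  field_simp
  have h' : ((j + m).choose m : ℝ≥0) * j.factorial * m.factorial = (j + m).factorial := by
    exact_mod_cast h
  rw [← h']
  ring

/-- The partition function of the hard-core model. -/
noncomputable def part (μ : Measure S) (R : S → S → Prop) (l : ℝ≥0) : ℝ≥0∞ :=
  ∑' k, weight l k * codeMeas μ R k

/-- The unnormalized expected number of points of the hard-core model. -/
noncomputable def points (μ : Measure S) (R : S → S → Prop) (l : ℝ≥0) : ℝ≥0∞ :=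
  ∑' k : ℕ, k * (weight l k * codeMeas μ R k)

theorem tsum_mul_weight (l : ℝ≥0) (f : ℕ → ℝ≥0∞) :
    ∑' k : ℕ, k * (weight l k * f k) = l * ∑' k, weight l k * f (k + 1) := by
  rw [tsum_eq_zero_add' ENNReal.summable, ← ENNReal.tsum_mul_left]
  simp only [Nat.cast_zero, zero_mul, zero_add]
  refine tsum_congr fun k => ?_
  rw [← mul_assoc, succ_mul_weight, mul_assoc]

theorem points_eq (μ : Measure S) (R : S → S → Prop) (l : ℝ≥0) :
    points μ R l = l * ∑' k, weight l k * codeMeas μ R (k + 1) :=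
  tsum_mul_weight l _

theorem one_le_part (μ : Measure S) (R : S → S → Prop) (l : ℝ≥0) : 1 ≤ part μ R l := by
  refine le_trans ?_ (ENNReal.le_tsum 0)
  simp [weight_zero, codeMeas_zero]

/-- Without the compatibility constraint the partition function would be exactly this exponential.
-/
theorem part_le_exp (μ : Measure S) [IsFiniteMeasure μ] (R : S → S → Prop) (l : ℝ≥0) :
    part μ R l ≤ ENNReal.ofReal (Real.exp (l * μ.real univ)) := by
  have h := NormedSpace.expSeries_div_hasSum_exp (l * μ.real univ : ℝ)
  rw [← Real.exp_eq_exp_ℝ] at h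
  rw [← h.tsum_eq, ENNReal.ofReal_tsum_of_nonneg (fun k => by positivity) h.summable]
  refine ENNReal.tsum_le_tsum fun k => ?_
  refine (mul_le_mul_right (codeMeas_le μ R k) _).trans (le_of_eq ?_)
  rw [← ENNReal.toReal_eq_toReal_iff' (by finiteness [weight_ne_top l k]) (by finiteness)]
  rw [ENNReal.toReal_ofReal (by positivity)]
  simp [weight, Measure.real]
  ring

/-- Sum `mul_codeMeas_le` over `k` with the weights. The identity `k * weight l k = l * weight l (k
- 1)` turns the main term into `points` and the error into a multiple of `part`. -/
theorem mul_part_le (μ : Measure S) [SigmaFinite μ] {R : S → S → Prop}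
    (hR : MeasurableSet {p : S × S | R p.1 p.2}) (hs : ∀ u v, R u v → R v u) (l : ℝ≥0)
    {κ : ℝ≥0∞} (hκ : l * (μ.prod μ) {p | ¬ R p.1 p.2} ≤ κ * μ univ) :
    l * μ univ * part μ R l ≤ points μ R l + κ * (l * μ univ * part μ R l) := by
  set G := (μ.prod μ) {p | ¬ R p.1 p.2}
  calc l * μ univ * part μ R l
      = l * ∑' k, weight l k * (μ univ * codeMeas μ R k) := by
        rw [part, mul_assoc, ← ENNReal.tsum_mul_left]
        congr 2 with k
        ring
    _ ≤ l * ∑' k, (weight l k * codeMeas μ R (k + 1) +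
          G * (k * (weight l k * codeMeas μ R (k - 1)))) := by
        gcongr with k
        refine (mul_le_mul_right (mul_codeMeas_le μ hR hs k) _).trans (le_of_eq ?_)
        ring
    _ = points μ R l + l * (l * G) * part μ R l := by
        rw [ENNReal.tsum_add, ENNReal.tsum_mul_left,
          tsum_mul_weight l fun k => codeMeas μ R (k - 1), mul_add, ← points_eq]
        simp only [Nat.add_sub_cancel]
        rw [← part]
        ring
    _ ≤ points μ R l + l * (κ * μ univ) * part μ R l := by gcongr
    _ = _ := by ring

/-- The parameter `b` balances two cases: if `Z` is large, so is the mean number of points; if `Z`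
is small, the empty configuration is likely. The bound is linear in `Z` and `Y`, so it can be
integrated over the outer configuration without normalizing. -/
theorem log_mul_part_le (μ : Measure S) [IsFiniteMeasure μ] {R : S → S → Prop}
    (hR : MeasurableSet {p : S × S | R p.1 p.2}) (hs : ∀ u v, R u v → R v u) (l : ℝ≥0)
    {κ b : ℝ} (hκ0 : 0 ≤ κ) (hκ1 : κ < 1) (hb : 1 ≤ b)
    (hκ : l * (μ.prod μ) {p | ¬ R p.1 p.2} ≤ ENNReal.ofReal κ * μ univ) :
    ENNReal.ofReal (1 + Real.log b) * part μ R l ≤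
      ENNReal.ofReal (1 - κ)⁻¹ * points μ R l + ENNReal.ofReal b := by
  have hκ' : 0 < (1 - κ)⁻¹ := inv_pos.2 (by linarith)
  by_cases hY : points μ R l = ∞
  · rw [hY, ENNReal.mul_top (by simpa using hκ1)]
    simp
  have hZ : part μ R l ≠ ∞ := ne_top_of_le_ne_top ENNReal.ofReal_ne_top (part_le_exp μ R l)
  have h1 := mul_part_le μ hR hs l hκ
  have h2 := part_le_exp μ R l
  have h3 := one_le_part μ R l
  obtain ⟨z, hz⟩ : ∃ z : ℝ≥0, part μ R l = z := ⟨_, (ENNReal.coe_toNNReal hZ).symm⟩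
  obtain ⟨y, hy⟩ : ∃ y : ℝ≥0, points μ R l = y := ⟨_, (ENNReal.coe_toNNReal hY).symm⟩
  obtain ⟨m, hm⟩ : ∃ m : ℝ≥0, μ univ = m := ⟨_, (ENNReal.coe_toNNReal (measure_ne_top μ _)).symm⟩
  have hlogb := Real.log_nonneg hb
  rw [hz] at h2 h3
  simp only [hz, hy, hm] at h1 ⊢
  have hm' : μ.real univ = m := by simp [Measure.real, hm]
  rw [hm', ← ENNReal.ofReal_coe_nnreal, ENNReal.ofReal_le_ofReal_iff (Real.exp_pos _).le] at h2
  have h3 : (1 : ℝ) ≤ z := by exact_mod_cast h3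
  rw [← ENNReal.ofReal_coe_nnreal, ← ENNReal.ofReal_coe_nnreal, ← ENNReal.ofReal_mul (by positivity),
    ← ENNReal.ofReal_mul (by positivity), ← ENNReal.ofReal_add (by positivity) (by positivity)]
  apply ENNReal.ofReal_le_ofReal
  have h1' : (l * m * z : ℝ) ≤ y + κ * (l * m * z) := by
    have := ENNReal.toReal_mono (by finiteness) h1
    rw [ENNReal.toReal_add (by finiteness) (by finiteness)] at this
    simpa [ENNReal.toReal_ofReal hκ0] using this
  have hlog : Real.log z ≤ l * m := (Real.log_le_iff_le_exp (by positivity)).2 h2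
  have hy' : (z : ℝ) * (l * m) ≤ (1 - κ)⁻¹ * y := by
    rw [inv_mul_eq_div, le_div_iff₀ (by linarith)]
    linarith
  -- The tangent line of the logarithm at `1` trades `log z` for the term `b / z`.
  have ht : Real.log (b / z) ≤ b / z - 1 := Real.log_le_sub_one_of_pos (by positivity)
  rw [Real.log_div (by positivity) (by positivity)] at ht
  have ht' : (z : ℝ) * (Real.log b - Real.log z) ≤ b - z := by
    have := mul_le_mul_of_nonneg_left ht (show (0 : ℝ) ≤ z by positivity)
    have e : (z : ℝ) * (b / z - 1) = b - z := by field_simp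
    linarith
  have := mul_le_mul_of_nonneg_left hlog (show (0 : ℝ) ≤ z by positivity)
  linarith

/-! ### Splitting a configuration along a set -/

/-- The measure of the codes `z` in `N` that extend a code `y` outside `N`. -/
noncomputable def extMeas (μ : Measure S) (R : S → S → Prop) (N : Set S) {j : ℕ} (m : ℕ)
    (y : Fin j → S) : ℝ≥0∞ :=
  Measure.pi (fun _ : Fin m => μ)
    {z | Sum.elim y z ∈ codeSet R (Fin j ⊕ Fin m) ∧ (∀ i, y i ∉ N) ∧ ∀ i, z i ∈ N}

theorem measurableSet_split {R : S → S → Prop} (hR : MeasurableSet {p : S × S | R p.1 p.2})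
    {N : Set S} (hN : MeasurableSet N) (j m : ℕ) :
    MeasurableSet {p : (Fin j → S) × (Fin m → S) |
      Sum.elim p.1 p.2 ∈ codeSet R (Fin j ⊕ Fin m) ∧ (∀ i, p.1 i ∉ N) ∧ ∀ i, p.2 i ∈ N} := by
  simp only [ofPred_and, ofPred_forall]
  refine .inter ?_ (.inter ?_ ?_)
  · exact (measurableSet_codeSet hR _).preimage
      (MeasurableEquiv.sumPiEquivProdPi fun _ : Fin j ⊕ Fin m => S).symm.measurable
  · refine .iInter fun i => hN.compl.preimage (f := fun p : (Fin j → S) × (Fin m → S) => p.1 i) ?_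
    fun_prop
  · refine .iInter fun i => hN.preimage (f := fun p : (Fin j → S) × (Fin m → S) => p.2 i) ?_
    fun_prop

theorem measurable_extMeas (μ : Measure S) [SigmaFinite μ] {R : S → S → Prop}
    (hR : MeasurableSet {p : S × S | R p.1 p.2}) {N : Set S} (hN : MeasurableSet N) (j m : ℕ) :
    Measurable fun y : Fin j → S => extMeas μ R N m y :=
  measurable_measure_prodMk_left (measurableSet_split hR hN j m)

/-- Relabel the indices so that those outside `I` come first, then apply Fubini. The integral
depends on `I` only through its cardinality. -/
theorem pi_split (μ : Measure S) [SigmaFinite μ] {R : S → S → Prop}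
    (hR : MeasurableSet {p : S × S | R p.1 p.2}) {N : Set S} (hN : MeasurableSet N)
    {k : ℕ} (I : Finset (Fin k)) :
    Measure.pi (fun _ : Fin k => μ) {x | x ∈ codeSet R (Fin k) ∧ ∀ i, x i ∈ N ↔ i ∈ I} =
      ∫⁻ y, extMeas μ R N I.card y ∂Measure.pi (fun _ : Fin (k - I.card) => μ) := by
  have hc : (Iᶜ).card = k - I.card := by rw [Finset.card_compl, Fintype.card_fin]
  let e := finSumEquivOfFinset (s := Iᶜ) (n := I.card) hc (by rw [compl_compl])
  have he1 : ∀ i, e (.inl i) ∉ I := fun i => by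
    have := Finset.orderEmbOfFin_mem Iᶜ hc i
    rwa [Finset.mem_compl] at this
  have he2 : ∀ i, e (.inr i) ∈ I := fun i => by
    have : e (.inr i) ∈ Iᶜᶜ := Finset.orderEmbOfFin_mem Iᶜᶜ (k := I.card) (by rw [compl_compl]) i
    simpa only [compl_compl] using this
  rw [← (measurePreserving_piCongrLeft (fun _ : Fin k => μ) e).measure_preimage_equiv,
    ← (measurePreserving_sumPiEquivProdPi_symm
      (fun _ : Fin (k - I.card) ⊕ Fin I.card => μ)).measure_preimage_equiv]
  have hset : (MeasurableEquiv.sumPiEquivProdPi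
        (fun _ : Fin (k - I.card) ⊕ Fin I.card => S)).symm ⁻¹'
      ((MeasurableEquiv.piCongrLeft (fun _ : Fin k => S) e) ⁻¹'
        {x | x ∈ codeSet R (Fin k) ∧ ∀ i, x i ∈ N ↔ i ∈ I}) =
      {p : (Fin (k - I.card) → S) × (Fin I.card → S) |
        Sum.elim p.1 p.2 ∈ codeSet R (Fin (k - I.card) ⊕ Fin I.card) ∧
          (∀ i, p.1 i ∉ N) ∧ ∀ i, p.2 i ∈ N} := by
    ext p
    set x := MeasurableEquiv.piCongrLeft (fun _ : Fin k => S) e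
      ((MeasurableEquiv.sumPiEquivProdPi
        (fun _ : Fin (k - I.card) ⊕ Fin I.card => S)).symm p) with hx
    have hxe : x ∘ e = Sum.elim p.1 p.2 := by
      ext i
      rw [Function.comp_apply, hx, MeasurableEquiv.piCongrLeft_apply_apply]
      cases i <;> rfl
    have hl : ∀ i, x (e (.inl i)) = p.1 i := fun i => congrFun hxe (.inl i)
    have hr : ∀ i, x (e (.inr i)) = p.2 i := fun i => congrFun hxe (.inr i)
    simp only [mem_preimage, mem_ofPred_eq]
    rw [← hx, ← hxe, mem_codeSet_comp_equiv]
    refine and_congr_right fun _ => ?_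
    rw [← e.forall_congr_right, Sum.forall]
    simp [hl, hr, he1, he2]
  rw [hset]
  exact Measure.prod_apply (measurableSet_split hR hN _ _)

open Classical in
/-- The number of points of a configuration in the set `N`. -/
noncomputable def count (N : Set S) {k : ℕ} (x : Fin k → S) : ℕ :=
  (Finset.univ.filter fun i => x i ∈ N).card

open Classical in
theorem lintegral_count (μ : Measure S) [SigmaFinite μ] {R : S → S → Prop}
    (hR : MeasurableSet {p : S × S | R p.1 p.2}) {N : Set S} (hN : MeasurableSet N)
    (w : ℕ → ℝ≥0∞) (k : ℕ) :
    ∫⁻ x in codeSet R (Fin k), w (count N x) ∂Measure.pi (fun _ : Fin k => μ) =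
      ∑ m ∈ Finset.range (k + 1), (k.choose m : ℝ≥0∞) * (w m *
        ∫⁻ y, extMeas μ R N m y ∂Measure.pi (fun _ : Fin (k - m) => μ)) := by
  have hC := measurableSet_codeSet hR (Fin k)
  have hE (I : Finset (Fin k)) :
      MeasurableSet {x | x ∈ codeSet R (Fin k) ∧ ∀ i, x i ∈ N ↔ i ∈ I} := by
    simp only [ofPred_and, ofPred_forall]
    refine hC.inter (.iInter fun i => ?_)
    by_cases hi : i ∈ I
    · simpa only [hi, iff_true] using! hN.preimage (f := fun x : Fin k → S => x i) (by fun_prop)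
    · simpa only [hi, iff_false] using! hN.compl.preimage (f := fun x : Fin k → S => x i) (by fun_prop)
  have hpt : ∀ x : Fin k → S, (codeSet R (Fin k)).indicator (fun x => w (count N x)) x =
      ∑ I : Finset (Fin k),
        {x | x ∈ codeSet R (Fin k) ∧ ∀ i, x i ∈ N ↔ i ∈ I}.indicator (fun _ => w I.card) x := by
    intro x
    by_cases hx : x ∈ codeSet R (Fin k)
    · rw [indicator_of_mem hx, Finset.sum_eq_single (Finset.univ.filter fun i => x i ∈ N)]
      · rw [indicator_of_mem (by simpa using hx), count]
      · intro I _ hI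
        refine indicator_of_notMem (fun h => hI ?_) _
        ext i
        simpa using (h.2 i).symm
      · simp
    · rw [indicator_of_notMem hx, Finset.sum_eq_zero]
      exact fun I _ => indicator_of_notMem (fun h => hx h.1) _
  rw [← lintegral_indicator hC]
  simp only [hpt]
  rw [lintegral_finsetSum _ fun I _ => measurable_const.indicator (hE I)]
  simp only [lintegral_indicator_const (hE _), pi_split μ hR hN]
  rw [← Finset.powerset_univ, Finset.sum_powerset_apply_card fun m => w m *
    ∫⁻ y, extMeas μ R N m y ∂Measure.pi (fun _ : Fin (k - m) => μ)]
  simp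

/-- This is the spatial Markov property in unnormalized form. Since `weight l (j + m)` times the
binomial coefficient is `weight l j * weight l m`, the sum over sizes factors into independent sums
over the numbers of points outside and inside `N`. -/
theorem tsum_lintegral_count (μ : Measure S) [SigmaFinite μ] {R : S → S → Prop}
    (hR : MeasurableSet {p : S × S | R p.1 p.2}) {N : Set S} (hN : MeasurableSet N) (l : ℝ≥0)
    (w : ℕ → ℝ≥0∞) :
    ∑' k, weight l k *
        ∫⁻ x in codeSet R (Fin k), w (count N x) ∂Measure.pi (fun _ : Fin k => μ) =
      ∑' j, weight l j * ∫⁻ y, ∑' m, w m * (weight l m * extMeas μ R N m y)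
        ∂Measure.pi (fun _ : Fin j => μ) := by
  set D : ℕ → ℕ → ℝ≥0∞ := fun j m => ∫⁻ y, extMeas μ R N m y ∂Measure.pi (fun _ : Fin j => μ)
  calc _ = ∑' k, ∑ p ∈ Finset.HasAntidiagonal.antidiagonal k,
        weight l p.1 * (w p.2 * (weight l p.2 * D p.1 p.2)) := by
        refine tsum_congr fun k => ?_
        rw [lintegral_count μ hR hN, Finset.mul_sum,
          ← Finset.Nat.sum_antidiagonal_eq_sum_range_succ_mk
            (f := fun p => weight l k * ((k.choose p.1 : ℝ≥0∞) * (w p.1 * D (k - p.1) p.1))),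
          ← Finset.Nat.sum_antidiagonal_swap]
        refine Finset.sum_congr rfl fun p hp => ?_
        rw [Finset.HasAntidiagonal.mem_antidiagonal] at hp
        subst hp
        simp only [Prod.fst_swap, Nat.add_sub_cancel]
        rw [← mul_assoc, weight_mul_choose]
        ring
    _ = ∑' p : ℕ × ℕ, weight l p.1 * (w p.2 * (weight l p.2 * D p.1 p.2)) := by
        rw [← (Finset.HasAntidiagonal.sigmaAntidiagonalEquivProd (A := ℕ)).tsum_eq, ENNReal.tsum_sigma']
        refine tsum_congr fun k => ?_
        rw [tsum_fintype, ← Finset.sum_coe_sort]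
        rfl
    _ = _ := by
        rw [ENNReal.tsum_prod']
        refine tsum_congr fun j => ?_
        dsimp only
        rw [ENNReal.tsum_mul_left, lintegral_tsum fun m =>
          (((measurable_extMeas μ hR hN j m).const_mul _).const_mul _).aemeasurable]
        congr 1
        refine tsum_congr fun m => ?_
        rw [lintegral_const_mul _ ((measurable_extMeas μ hR hN j m).const_mul _),
          lintegral_const_mul _ (measurable_extMeas μ hR hN j m)]

/-! ### Local estimate and its average over the space -/

/-- A local estimate, conditional on the part of the configuration outside `N`. -/
theorem log_mul_part_le_of_local (μ : Measure S) [IsFiniteMeasure μ] {R : S → S → Prop}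
    (hR : MeasurableSet {p : S × S | R p.1 p.2}) (hs : ∀ u v, R u v → R v u) (l : ℝ≥0)
    {κ b : ℝ} (hκ0 : 0 ≤ κ) (hκ1 : κ < 1) (hb : 1 ≤ b) {N : Set S} (hN : MeasurableSet N)
    (hκ : ∀ T ⊆ N, MeasurableSet T →
      l * (μ.prod μ) {p | p.1 ∈ T ∧ p.2 ∈ T ∧ ¬ R p.1 p.2} ≤ ENNReal.ofReal κ * μ T) :
    ENNReal.ofReal (1 + Real.log b) * part μ R l ≤
      ENNReal.ofReal (1 - κ)⁻¹ * ∑' k, weight l k *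
        ∫⁻ x in codeSet R (Fin k), (count N x : ℝ≥0∞) ∂Measure.pi (fun _ : Fin k => μ) +
      ENNReal.ofReal b * ∑' k, weight l k * Measure.pi (fun _ : Fin k => μ)
        {y | y ∈ codeSet R (Fin k) ∧ ∀ i, y i ∉ N} := by
  have hF (j : ℕ) : MeasurableSet {y : Fin j → S | y ∈ codeSet R (Fin j) ∧ ∀ i, y i ∉ N} := by
    simp only [ofPred_and, ofPred_forall]
    exact (measurableSet_codeSet hR _).inter
      (.iInter fun i => hN.compl.preimage (measurable_pi_apply i))
  have hpt (j : ℕ) (y : Fin j → S) :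
      ENNReal.ofReal (1 + Real.log b) * ∑' m, 1 * (weight l m * extMeas μ R N m y) ≤
        ENNReal.ofReal (1 - κ)⁻¹ * ∑' m : ℕ, m * (weight l m * extMeas μ R N m y) +
        {y : Fin j → S | y ∈ codeSet R (Fin j) ∧ ∀ i, y i ∉ N}.indicator
          (fun _ => ENNReal.ofReal b) y := by
    by_cases hy : y ∈ {y : Fin j → S | y ∈ codeSet R (Fin j) ∧ ∀ i, y i ∉ N}
    · rw [indicator_of_mem hy]
      -- The part of `N` not blocked by `y`. Extensions of `y` inside `N` are exactly the codes in
      -- `T`, so the conditional model is the hard-core model of `μ.restrict T`.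
      set T : Set S := N ∩ {v | ∀ i, R (y i) v}
      have hT : MeasurableSet T := by
        refine hN.inter ?_
        simp only [ofPred_forall]
        exact .iInter fun i => hR.preimage (f := fun v => (y i, v)) (by fun_prop)
      have hext (m : ℕ) : extMeas μ R N m y = codeMeas (μ.restrict T) R m := by
        rw [codeMeas, ← Measure.restrict_pi_pi,
          Measure.restrict_apply (measurableSet_codeSet hR _), extMeas]
        congr 1
        ext z
        simp only [mem_ofPred_eq, elim_mem_codeSet hs, mem_inter_iff, mem_univ_pi, T]
        exact ⟨fun h => ⟨h.1.2.1, fun i => ⟨h.2.2 i, fun a => h.1.2.2 a i⟩⟩,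
          fun h => ⟨⟨hy.1, h.1, fun a i => (h.2 i).2 a⟩, hy.2, fun i => (h.2 i).1⟩⟩
      simp only [hext, one_mul]
      refine log_mul_part_le (μ.restrict T) hR hs l hκ0 hκ1 hb ?_
      have hRc : MeasurableSet {p : S × S | ¬ R p.1 p.2} := hR.compl
      rw [Measure.prod_restrict, Measure.restrict_apply hRc, Measure.restrict_apply_univ]
      convert hκ T inter_subset_left hT using 4
      ext p
      simp only [mem_inter_iff, mem_ofPred_eq, mem_prod]
      tauto
    · have : ∀ m, extMeas μ R N m y = 0 := fun m => by
        rw [extMeas]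
        convert measure_empty (μ := Measure.pi fun _ : Fin m => μ)
        refine eq_empty_of_forall_notMem fun z hz => hy ?_
        exact ⟨((elim_mem_codeSet hs _ _).1 hz.1).1, hz.2.1⟩
      simp [this]
  have h1 : part μ R l = ∑' k, weight l k *
      ∫⁻ x in codeSet R (Fin k), (fun _ : ℕ => 1) (count N x) ∂Measure.pi (fun _ : Fin k => μ) := by
    simp [part, codeMeas]
  rw [h1, tsum_lintegral_count μ hR hN l fun _ => 1,
    tsum_lintegral_count μ hR hN l fun m => (m : ℝ≥0∞),
    ← ENNReal.tsum_mul_left, ← ENNReal.tsum_mul_left, ← ENNReal.tsum_mul_left, ← ENNReal.tsum_add]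
  refine ENNReal.tsum_le_tsum fun j => ?_
  calc _ = weight l j * ∫⁻ y, ENNReal.ofReal (1 + Real.log b) *
        ∑' m, 1 * (weight l m * extMeas μ R N m y) ∂Measure.pi (fun _ : Fin j => μ) := by
        rw [lintegral_const_mul' _ _ ENNReal.ofReal_ne_top]
        ring
    _ ≤ weight l j * ∫⁻ y, (ENNReal.ofReal (1 - κ)⁻¹ *
          ∑' m : ℕ, m * (weight l m * extMeas μ R N m y) +
        {y : Fin j → S | y ∈ codeSet R (Fin j) ∧ ∀ i, y i ∉ N}.indicator
          (fun _ => ENNReal.ofReal b) y) ∂Measure.pi (fun _ : Fin j => μ) := by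
        gcongr with y
        exact hpt j y
    _ = _ := by
        rw [lintegral_add_right _ (measurable_const.indicator (hF j)),
          lintegral_const_mul' _ _ ENNReal.ofReal_ne_top, lintegral_indicator_const (hF j)]
        ring

/-- The occupancy bound of the hard-core model on a space whose conflict neighbourhoods have
measure at most `s`. -/
theorem log_mul_part_le_points (μ : Measure S) [IsProbabilityMeasure μ] {R : S → S → Prop}
    (hR : MeasurableSet {p : S × S | R p.1 p.2}) (hs : ∀ u v, R u v → R v u) {l : ℝ≥0}
    (hl : l ≠ 0) {κ b s : ℝ} (hκ0 : 0 ≤ κ) (hκ1 : κ < 1) (hb : 1 ≤ b)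
    (hs' : ∀ u, μ {x | ¬ R x u} ≤ ENNReal.ofReal s)
    (hκ : ∀ x, ∀ T ⊆ {u | ¬ R x u}, MeasurableSet T →
      l * (μ.prod μ) {p | p.1 ∈ T ∧ p.2 ∈ T ∧ ¬ R p.1 p.2} ≤ ENNReal.ofReal κ * μ T) :
    ENNReal.ofReal (1 + Real.log b) * part μ R l ≤
      (ENNReal.ofReal (1 - κ)⁻¹ * ENNReal.ofReal s + ENNReal.ofReal b * (l : ℝ≥0∞)⁻¹) *
        points μ R l := by
  have hN (x : S) : MeasurableSet {u | ¬ R x u} :=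
    hR.compl.preimage (f := fun u => (x, u)) (by fun_prop)
  have hcount (k : ℕ) (x : S) (y : Fin k → S) : (count {u | ¬ R x u} y : ℝ≥0∞) =
      ∑ i, {p : S × (Fin k → S) | ¬ R p.1 (p.2 i)}.indicator (fun _ => 1) (x, y) := by
    classical
    simp [count, indicator_apply, Finset.sum_ite]
  have hm (k : ℕ) (i : Fin k) : MeasurableSet {p : S × (Fin k → S) | ¬ R p.1 (p.2 i)} :=
    hR.compl.preimage (f := fun p : S × (Fin k → S) => (p.1, p.2 i)) (by fun_prop)
  have hmc (k : ℕ) : Measurable fun p : S × (Fin k → S) => (count {u | ¬ R p.1 u} p.2 : ℝ≥0∞) := by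
    simp only [hcount]
    exact Finset.measurable_sum _ fun i _ => measurable_const.indicator (hm k i)
  have hmF (k : ℕ) : MeasurableSet {p : S × (Fin k → S) |
      p.2 ∈ codeSet R (Fin k) ∧ ∀ i, p.2 i ∉ {u | ¬ R p.1 u}} := by
    simp only [ofPred_and, ofPred_forall]
    refine ((measurableSet_codeSet hR _).preimage measurable_snd).inter (.iInter fun i => ?_)
    simpa using! hR.preimage (f := fun p : S × (Fin k → S) => (p.1, p.2 i)) (by fun_prop)
  -- Swap the integrals: each point of the configuration is counted by a set of `x` of measure at
  -- most `s`.
  have h1 : ∫⁻ x, ∑' k, weight l k * ∫⁻ y in codeSet R (Fin k), (count {u | ¬ R x u} y : ℝ≥0∞)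
      ∂Measure.pi (fun _ : Fin k => μ) ∂μ ≤ ENNReal.ofReal s * points μ R l := by
    have hmi (k : ℕ) : Measurable fun x => ∫⁻ y in codeSet R (Fin k),
        (count {u | ¬ R x u} y : ℝ≥0∞) ∂Measure.pi (fun _ : Fin k => μ) :=
      (hmc k).lintegral_prod_right'
    rw [lintegral_tsum fun k => ((hmi k).const_mul _).aemeasurable, points,
      ← ENNReal.tsum_mul_left]
    refine ENNReal.tsum_le_tsum fun k => ?_
    rw [lintegral_const_mul _ (hmi k), lintegral_lintegral_swap (hmc k).aemeasurable]
    calc _ ≤ weight l k * ∫⁻ y in codeSet R (Fin k), k * ENNReal.ofReal s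
          ∂Measure.pi (fun _ : Fin k => μ) := by
          gcongr with y
          simp only [hcount]
          have hmm (i : Fin k) : Measurable fun x =>
              {p : S × (Fin k → S) | ¬ R p.1 (p.2 i)}.indicator (fun _ => (1 : ℝ≥0∞)) (x, y) :=
            (measurable_const.indicator (hm k i)).comp measurable_prodMk_right
          rw [lintegral_finsetSum _ fun i _ => hmm i]
          refine (Finset.sum_le_sum fun i _ => ?_).trans_eq (b := ∑ _ : Fin k, ENNReal.ofReal s)
            (by simp)
          refine le_trans (le_of_eq ?_) (hs' (y i))
          exact lintegral_indicator_one ((hm k i).preimage measurable_prodMk_right)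
      _ = _ := by
          rw [setLIntegral_const, codeMeas]
          ring
  -- A code that avoids the conflicts of `x` becomes, with `x` added, a code with one more point;
  -- the shift of index costs the factor `l⁻¹`.
  have h2 : ∫⁻ x, ∑' k, weight l k * Measure.pi (fun _ : Fin k => μ)
      {y | y ∈ codeSet R (Fin k) ∧ ∀ i, y i ∉ {u | ¬ R x u}} ∂μ = (l : ℝ≥0∞)⁻¹ * points μ R l := by
    have hmi (k : ℕ) : Measurable fun x => Measure.pi (fun _ : Fin k => μ)
      {y | y ∈ codeSet R (Fin k) ∧ ∀ i, y i ∉ {u | ¬ R x u}} :=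
      measurable_measure_prodMk_left (hmF k)
    rw [lintegral_tsum fun k => ((hmi k).const_mul _).aemeasurable, points_eq, ← mul_assoc,
      ENNReal.inv_mul_cancel (by simpa using hl) ENNReal.coe_ne_top, one_mul]
    refine tsum_congr fun k => ?_
    rw [lintegral_const_mul _ (hmi k), codeMeas_succ μ hs]
    have := Measure.prod_apply (μ := μ) (ν := Measure.pi fun _ : Fin k => μ) (hmF k)
    simp only [mem_ofPred_eq, not_not] at this
    simp only [mem_ofPred_eq, not_not, this]
    rfl
  calc _ = ∫⁻ _, ENNReal.ofReal (1 + Real.log b) * part μ R l ∂μ := by simp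
    _ ≤ ∫⁻ x, _ ∂μ := lintegral_mono fun x =>
        log_mul_part_le_of_local μ hR hs l hκ0 hκ1 hb (hN x) (hκ x)
    _ ≤ _ := by
        rw [lintegral_add_right', lintegral_const_mul' _ _ ENNReal.ofReal_ne_top,
          lintegral_const_mul' _ _ ENNReal.ofReal_ne_top, h2, add_mul, mul_assoc, mul_assoc]
        · gcongr
        · refine Measurable.aemeasurable (.const_mul (.tsum fun k => .const_mul ?_ _) _)
          exact measurable_measure_prodMk_left (hmF k)

end HardCore

open MeasureTheory Set
open scoped ENNReal NNReal Pointwise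

/-! ### Conflicts inside a spherical cap -/

namespace SphericalCode

/-- Compatibility of two points of a spherical code of angle `θ`. -/
def Compat {d : ℕ} (θ : ℝ) (u v : Sph d) : Prop :=
  inner ℝ (u : EuclideanSpace ℝ (Fin d)) (v : EuclideanSpace ℝ (Fin d)) ≤ Real.cos θ

theorem measurableSet_compat {d : ℕ} (θ : ℝ) :
    MeasurableSet {p : Sph d × Sph d | Compat θ p.1 p.2} := by
  apply IsClosed.measurableSet
  exact isClosed_le (by fun_prop) continuous_const

theorem Compat.symm {d : ℕ} {θ : ℝ} {u v : Sph d} (h : Compat θ u v) : Compat θ v u := by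
  rwa [Compat, real_inner_comm]

theorem codeProb_eq (d : ℕ) (θ : ℝ) (n : ℕ) :
    codeProb d θ n = (HardCore.codeMeas (surf d) (Compat (d := d) θ) n).toReal := rfl

theorem surf_cap {d : ℕ} [NeZero d] (θ : ℝ) (x : Sph d) :
    surf d (cap θ x) = ENNReal.ofReal (capArea d θ) := by
  have := isProbabilityMeasure_surf d
  rw [capArea_eq θ x, ofReal_measureReal]

section Angles

variable {θ : ℝ}

theorem cos_pos_of_mem (hθ : θ ∈ Ioo 0 (Real.pi / 2)) : 0 < Real.cos θ :=
  Real.cos_pos_of_mem_Ioo ⟨by linarith [hθ.1, Real.pi_pos], hθ.2⟩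

theorem sin_pos_of_mem (hθ : θ ∈ Ioo 0 (Real.pi / 2)) : 0 < Real.sin θ :=
  Real.sin_pos_of_pos_of_lt_pi hθ.1 (by linarith [hθ.2, Real.pi_pos])

theorem cos_lt_one_of_mem (hθ : θ ∈ Ioo 0 (Real.pi / 2)) : Real.cos θ < 1 := by
  nlinarith [Real.sin_sq_add_cos_sq θ, sin_pos_of_mem hθ, cos_pos_of_mem hθ]

theorem radius_sq (hθ : θ ∈ Ioo 0 (Real.pi / 2)) :
    (√((Real.cos θ - 1) ^ 2 * (1 + 2 * Real.cos θ)) / Real.sin θ) ^ 2 =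
      (1 - Real.cos θ) * (1 + 2 * Real.cos θ) / (1 + Real.cos θ) := by
  have h1 := cos_pos_of_mem hθ
  have h2 := cos_lt_one_of_mem hθ
  have h3 : Real.sin θ ^ 2 = (1 - Real.cos θ) * (1 + Real.cos θ) := by
    linarith [Real.sin_sq_add_cos_sq θ]
  rw [div_pow, Real.sq_sqrt (by positivity), h3]
  have : 1 - Real.cos θ ≠ 0 := by linarith
  field_simp
  ring

theorem radius_lt (hθ : θ ∈ Ioo 0 (Real.pi / 2)) :
    √((Real.cos θ - 1) ^ 2 * (1 + 2 * Real.cos θ)) / Real.sin θ < Real.sin θ := by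
  have h1 := cos_pos_of_mem hθ
  have h2 := cos_lt_one_of_mem hθ
  refine lt_of_pow_lt_pow_left₀ 2 (sin_pos_of_mem hθ).le ?_
  rw [radius_sq hθ, div_lt_iff₀ (by linarith), Real.sin_sq]
  nlinarith [mul_pos (sub_pos.2 h2) (pow_pos h1 2)]

theorem radius_pos (hθ : θ ∈ Ioo 0 (Real.pi / 2)) :
    0 < √((Real.cos θ - 1) ^ 2 * (1 + 2 * Real.cos θ)) / Real.sin θ := by
  have h1 := cos_pos_of_mem hθ
  have h2 := cos_lt_one_of_mem hθ
  have : 0 < (Real.cos θ - 1) ^ 2 := by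
    have : Real.cos θ - 1 ≠ 0 := by linarith
    positivity
  exact div_pos (Real.sqrt_pos.2 (by positivity)) (sin_pos_of_mem hθ)

theorem sin_q (hθ : θ ∈ Ioo 0 (Real.pi / 2)) :
    Real.sin (q θ) = √((Real.cos θ - 1) ^ 2 * (1 + 2 * Real.cos θ)) / Real.sin θ :=
  Real.sin_arcsin (by linarith [radius_pos hθ]) ((radius_lt hθ).le.trans (Real.sin_le_one θ))

theorem sin_q_lt (hθ : θ ∈ Ioo 0 (Real.pi / 2)) : Real.sin (q θ) < Real.sin θ := by
  rw [sin_q hθ]; exact radius_lt hθ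

theorem q_mem (hθ : θ ∈ Ioo 0 (Real.pi / 2)) : q θ ∈ Ioo 0 (Real.pi / 2) :=
  ⟨Real.arcsin_pos.2 (radius_pos hθ),
    Real.arcsin_lt_pi_div_two.2 ((radius_lt hθ).trans_le (Real.sin_le_one θ))⟩

/-- The form in which `q` enters the geometry: it is the squared cosine threshold found in
`exists_cap_q` when `x` and `u` are at angle exactly `θ`. -/
theorem cos_q_sq (hθ : θ ∈ Ioo 0 (Real.pi / 2)) :
    Real.cos (q θ) ^ 2 = 2 * Real.cos θ ^ 2 / (1 + Real.cos θ) := by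
  have h1 := cos_pos_of_mem hθ
  rw [Real.cos_sq', sin_q hθ, radius_sq hθ]
  field_simp
  ring

theorem c_pos (hθ : θ ∈ Ioo 0 (Real.pi / 2)) : 0 < c θ :=
  Real.log_pos ((one_lt_div (sin_pos_of_mem (q_mem hθ))).2 (sin_q_lt hθ))

end Angles

/-- The half of the intersection of two caps that is farther from `u` lies in a cap of
radius `q θ`. -/
theorem exists_cap_q {d : ℕ} {θ : ℝ} (hθ : θ ∈ Ioo 0 (Real.pi / 2)) {x u : Sph d}
    (hu : ¬ Compat θ x u) :
    ∃ w : Sph d, ∀ v : Sph d, ¬ Compat θ u v →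
      inner ℝ (x : EuclideanSpace ℝ (Fin d)) (u : EuclideanSpace ℝ (Fin d)) ≤
        inner ℝ (x : EuclideanSpace ℝ (Fin d)) (v : EuclideanSpace ℝ (Fin d)) →
      v ∈ cap (q θ) w := by
  have hc := cos_pos_of_mem hθ
  have hc1 := cos_lt_one_of_mem hθ
  rw [Compat, not_le] at hu
  set t := inner ℝ (x : EuclideanSpace ℝ (Fin d)) (u : EuclideanSpace ℝ (Fin d)) with ht
  set y : EuclideanSpace ℝ (Fin d) := x + u with hy
  have hxn : ‖(x : EuclideanSpace ℝ (Fin d))‖ = 1 := by simp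
  have hun : ‖(u : EuclideanSpace ℝ (Fin d))‖ = 1 := by simp
  have hn : ‖y‖ ^ 2 = 2 + 2 * t := by
    rw [hy, norm_add_sq_real, hxn, hun, ← ht]; ring
  have hy0 : 0 < ‖y‖ := by
    refine (norm_nonneg y).lt_of_ne fun h => ?_
    rw [← h] at hn
    linarith
  -- The cap is centred at the midpoint direction of `x` and `u`. The squared cosine to be bounded
  -- is at least `(cos θ + t) ^ 2 / (2 + 2 * t)`, which increases with `t`, so the extreme case is
  -- `t = cos θ`.
  refine ⟨⟨‖y‖⁻¹ • y, by simp [norm_smul, hy0.ne']⟩, fun v hv hxv => ?_⟩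
  rw [Compat, not_le] at hv
  simp only [cap, mem_ofPred_eq, real_inner_smul_left]
  have hyv : Real.cos θ + t ≤ inner ℝ y (v : EuclideanSpace ℝ (Fin d)) := by
    rw [hy, inner_add_left]; linarith
  rw [inv_mul_eq_div, le_div_iff₀ hy0]
  refine le_trans ?_ hyv
  refine le_of_sq_le_sq ?_ (by linarith)
  rw [mul_pow, cos_q_sq hθ, hn, div_mul_eq_mul_div, div_le_iff₀ (by linarith)]
  nlinarith [mul_pos hc (sub_pos.2 hu), mul_pos (sub_pos.2 hu) (sub_pos.2 hu),
    mul_pos hc (mul_pos hc (sub_pos.2 hu)), mul_pos hc (mul_pos (sub_pos.2 hu) (sub_pos.2 hu))]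

/-- Order each conflicting pair so that the second point is at least as close to `x`. Given the
first, the second then lies in a cap of radius `q θ`; the two possible orders cost the factor `2`.
-/
theorem prod_conflict_le {d : ℕ} [NeZero d] {θ : ℝ} (hθ : θ ∈ Ioo 0 (Real.pi / 2)) {x : Sph d}
    {T : Set (Sph d)} (hTx : T ⊆ {u | ¬ Compat θ x u}) (hT : MeasurableSet T) :
    ((surf d).prod (surf d)) {p | p.1 ∈ T ∧ p.2 ∈ T ∧ ¬ Compat θ p.1 p.2} ≤
      ENNReal.ofReal (2 * capArea d (q θ)) * surf d T := by
  have := isProbabilityMeasure_surf d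
  set C := {p : Sph d × Sph d | p.1 ∈ T ∧ ¬ Compat θ p.1 p.2 ∧
    inner ℝ (x : EuclideanSpace ℝ (Fin d)) (p.1 : EuclideanSpace ℝ (Fin d)) ≤
        inner ℝ (x : EuclideanSpace ℝ (Fin d)) (p.2 : EuclideanSpace ℝ (Fin d))} with hC
  have hCm : MeasurableSet C := by
    rw [hC]
    simp only [ofPred_and]
    refine (hT.preimage measurable_fst).inter ((measurableSet_compat θ).compl.inter ?_)
    exact (isClosed_le (by fun_prop) (by fun_prop)).measurableSet
  have hCle : ((surf d).prod (surf d)) C ≤ ENNReal.ofReal (capArea d (q θ)) * surf d T := by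
    rw [Measure.prod_apply hCm, ← lintegral_indicator_const hT]
    refine lintegral_mono fun u => ?_
    by_cases hu : u ∈ T
    · rw [indicator_of_mem hu]
      obtain ⟨w, hw⟩ := exists_cap_q hθ (hTx hu)
      rw [← surf_cap (q θ) w]
      exact measure_mono fun v hv => hw v hv.2.1 hv.2.2
    · rw [indicator_of_notMem hu, nonpos_iff_eq_zero]
      convert measure_empty (μ := surf d)
      exact eq_empty_of_forall_notMem fun v hv => hu hv.1
  calc _ ≤ ((surf d).prod (surf d)) (C ∪ Prod.swap ⁻¹' C) := by
        refine measure_mono fun p hp => ?_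
        rcases le_total (inner ℝ (x : EuclideanSpace ℝ (Fin d)) (p.1 : EuclideanSpace ℝ (Fin d)))
          (inner ℝ (x : EuclideanSpace ℝ (Fin d)) (p.2 : EuclideanSpace ℝ (Fin d))) with h | h
        · exact .inl ⟨hp.1, hp.2.2, h⟩
        · exact .inr ⟨hp.2.1, fun h' => hp.2.2 h'.symm, h⟩
    _ ≤ ((surf d).prod (surf d)) C + ((surf d).prod (surf d)) (Prod.swap ⁻¹' C) :=
        measure_union_le _ _
    _ ≤ _ := by
        rw [Measure.measurePreserving_swap.measure_preimage hCm.nullMeasurableSet,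
          ENNReal.ofReal_mul zero_le_two, ENNReal.ofReal_ofNat, two_mul, add_mul]
        gcongr

/-! ### Volume estimates for caps and codes -/

section Volume

variable {d : ℕ} [NeZero d]

/-- The normalized surface area of a set is the normalized volume of the cone over it. -/
theorem surf_mul_volume_ball {s : Set (Sph d)} (hs : MeasurableSet s) :
    surf d s * volume (Metric.ball (0 : EuclideanSpace ℝ (Fin d)) 1) =
      volume (Ioo (0 : ℝ) 1 • ((↑) '' s : Set (EuclideanSpace ℝ (Fin d)))) := by
  have hb0 : volume (Metric.ball (0 : EuclideanSpace ℝ (Fin d)) 1) ≠ 0 :=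
    (Metric.measure_ball_pos _ _ one_pos).ne'
  have hbt : volume (Metric.ball (0 : EuclideanSpace ℝ (Fin d)) 1) ≠ ∞ :=
    measure_ball_lt_top.ne
  have hd0 : (d : ℝ≥0∞) ≠ 0 := by simpa using NeZero.ne d
  rw [surf, Measure.smul_apply, Measure.toSphere_apply_univ, Measure.toSphere_apply' _ hs,
    finrank_euclideanSpace_fin, smul_eq_mul,
    ENNReal.mul_inv (.inl hd0) (.inl (ENNReal.natCast_ne_top d))]
  calc _ = ((d : ℝ≥0∞)⁻¹ * d) * ((volume (Metric.ball (0 : EuclideanSpace ℝ (Fin d)) 1))⁻¹ *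
      volume (Metric.ball (0 : EuclideanSpace ℝ (Fin d)) 1)) *
      volume (Ioo (0 : ℝ) 1 • ((↑) '' s : Set (EuclideanSpace ℝ (Fin d)))) := by ring
    _ = _ := by
      rw [ENNReal.inv_mul_cancel hd0 (ENNReal.natCast_ne_top d), ENNReal.inv_mul_cancel hb0 hbt,
        one_mul, one_mul]

omit [NeZero d] in
theorem mem_cone_cap {φ : ℝ} {x : Sph d} {v : EuclideanSpace ℝ (Fin d)} :
    v ∈ Ioo (0 : ℝ) 1 • ((↑) '' cap φ x : Set (EuclideanSpace ℝ (Fin d))) ↔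
      v ≠ 0 ∧ ‖v‖ < 1 ∧ Real.cos φ * ‖v‖ ≤ inner ℝ (x : EuclideanSpace ℝ (Fin d)) v := by
  simp only [mem_smul, mem_image]
  constructor
  · rintro ⟨r, hr, _, ⟨z, hz, rfl⟩, rfl⟩
    have hz1 : ‖(z : EuclideanSpace ℝ (Fin d))‖ = 1 := by simp
    have hn : ‖r • (z : EuclideanSpace ℝ (Fin d))‖ = r := by
      rw [norm_smul, hz1, mul_one, Real.norm_of_nonneg hr.1.le]
    refine ⟨?_, ?_, ?_⟩
    · rw [← norm_ne_zero_iff, hn]; exact hr.1.ne'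
    · rw [hn]; exact hr.2
    · rw [hn, real_inner_smul_right, mul_comm]
      exact mul_le_mul_of_nonneg_left hz hr.1.le
  · rintro ⟨h0, h1, h2⟩
    have hn : 0 < ‖v‖ := norm_pos_iff.2 h0
    refine ⟨‖v‖, ⟨hn, h1⟩, _, ⟨⟨‖v‖⁻¹ • v, by simp [norm_smul, hn.ne']⟩, ?_, rfl⟩, ?_⟩
    · simp only [cap, mem_ofPred_eq, real_inner_smul_right]
      rwa [inv_mul_eq_div, le_div_iff₀ hn]
    · rw [smul_inv_smul₀ hn.ne']

omit [NeZero d] in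
theorem capArea_nonneg (φ : ℝ) : 0 ≤ capArea d φ :=
  Real.iSup_nonneg fun _ => measureReal_nonneg

/-- The cone over the cap, apart from a scaled copy of itself near the apex, fits in a ball of
radius `sin φ`. Comparing volumes bounds the cap area in terms of itself. -/
theorem capArea_mul_le {φ : ℝ} (hφ : φ ∈ Ioo 0 (Real.pi / 2)) :
    capArea d φ * (1 - (Real.cos φ ^ 2) ^ d) ≤ Real.sin φ ^ d := by
  have := isProbabilityMeasure_surf d
  have hc := cos_pos_of_mem hφ
  have hc1 := cos_lt_one_of_mem hφ
  have hsin := sin_pos_of_mem hφ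
  have hcs := Real.sin_sq_add_cos_sq φ
  have : Nontrivial (EuclideanSpace ℝ (Fin d)) := by
    have : Nonempty (Fin d) := ⟨0⟩
    infer_instance
  obtain ⟨x⟩ : Nonempty (Sph d) := (NormedSpace.sphere_nonempty.2 zero_le_one).to_subtype
  set K := Ioo (0 : ℝ) 1 • ((↑) '' cap φ x : Set (EuclideanSpace ℝ (Fin d))) with hK
  set B := volume (Metric.ball (0 : EuclideanSpace ℝ (Fin d)) 1)
  have hb0 : B ≠ 0 := (Metric.measure_ball_pos _ _ one_pos).ne'
  have hbt : B ≠ ∞ := measure_ball_lt_top.ne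
  have hKsub : K ⊆ (Real.cos φ ^ 2) • K ∪
      Metric.closedBall (Real.cos φ • (x : EuclideanSpace ℝ (Fin d))) (Real.sin φ) := by
    intro v hv
    have hv' := mem_cone_cap.1 hv
    obtain ⟨h0, h1, h2⟩ := hv'
    -- The ball covers all norms from `2 * cos φ ^ 2 - 1` to `1`. The cut at `cos φ ^ 2` lies in
    -- this range and is always positive, so it can serve as a scaling factor.
    by_cases hr : ‖v‖ < Real.cos φ ^ 2
    · left
      rw [mem_smul_set_iff_inv_smul_mem₀ (by positivity), hK, mem_cone_cap]
      refine ⟨by simp [h0, hc.ne'], ?_, ?_⟩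
      · rw [norm_smul, norm_inv, Real.norm_of_nonneg (by positivity), inv_mul_eq_div,
          div_lt_one (by positivity)]
        exact hr
      · rw [norm_smul, norm_inv, Real.norm_of_nonneg (by positivity), real_inner_smul_right,
          mul_left_comm]
        gcongr
    · right
      rw [not_lt] at hr
      rw [mem_closedBall_iff_norm]
      refine le_of_sq_le_sq ?_ hsin.le
      have hxn : ‖(x : EuclideanSpace ℝ (Fin d))‖ = 1 := by simp
      rw [norm_sub_sq_real, norm_smul, hxn, real_inner_smul_right, real_inner_comm,
        Real.norm_of_nonneg hc.le]
      nlinarith [mul_le_mul_of_nonneg_left h2 hc.le,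
        mul_nonneg (sub_nonneg.2 hr) (sub_nonneg.2 h1.le)]
  have hvol := surf_mul_volume_ball (measurableSet_cap φ x)
  rw [← hK, surf_cap] at hvol
  have hle := (measure_mono (μ := volume) hKsub).trans (measure_union_le _ _)
  rw [Measure.addHaar_smul, Measure.addHaar_closedBall _ _ hsin.le, finrank_euclideanSpace_fin,
    ← hvol, abs_of_nonneg (by positivity), ← mul_assoc, ← add_mul,
    ENNReal.mul_le_mul_iff_left hb0 hbt, ← ENNReal.ofReal_mul (by positivity),
    ← ENNReal.ofReal_add (by have := capArea_nonneg (d := d) φ; positivity) (by positivity),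
    ENNReal.ofReal_le_ofReal_iff (by have := capArea_nonneg (d := d) φ; positivity)] at hle
  linarith

end Volume

/-- The cone over the cap contains an ellipsoid with half-axis `η` along the axis and `ρ` in the
other `d` directions, lying between heights `cos φ - 2 * η` and `cos φ`. Here `ρ` is the radius of
the cone at the lower height. -/
theorem le_capArea {d : ℕ} {φ η : ℝ} (hφ : φ ∈ Ioo 0 (Real.pi / 2)) (hη : 0 < η)
    (hη' : 2 * η < Real.cos φ) :
    η * (Real.sin φ - 2 * η * Real.tan φ) ^ d ≤ capArea (d + 1) φ := by
  have := isProbabilityMeasure_surf (d + 1)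
  have hc := cos_pos_of_mem hφ
  have hc1 := cos_lt_one_of_mem hφ
  have hsin := sin_pos_of_mem hφ
  have hcs := Real.sin_sq_add_cos_sq φ
  set ρ := Real.sin φ - 2 * η * Real.tan φ with hρ
  have hρc : ρ * Real.cos φ = Real.sin φ * (Real.cos φ - 2 * η) := by
    rw [hρ, Real.tan_eq_sin_div_cos]; field_simp
  have hρ0 : 0 < ρ := by
    refine pos_of_mul_pos_left (b := Real.cos φ) ?_ hc.le
    rw [hρc]; exact mul_pos hsin (by linarith)
  have hρs : ρ ≤ Real.sin φ := by
    refine le_of_mul_le_mul_right ?_ hc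
    rw [hρc]; nlinarith
  set e : EuclideanSpace ℝ (Fin (d + 1)) := EuclideanSpace.single 0 1 with he
  let x : Sph (d + 1) := ⟨e, by simp [he]⟩
  set K := Ioo (0 : ℝ) 1 • ((↑) '' cap φ x : Set (EuclideanSpace ℝ (Fin (d + 1)))) with hK
  set B := volume (Metric.ball (0 : EuclideanSpace ℝ (Fin (d + 1))) 1)
  have hb0 : B ≠ 0 := (Metric.measure_ball_pos _ _ one_pos).ne'
  have hbt : B ≠ ∞ := measure_ball_lt_top.ne
  let w : Fin (d + 1) → ℝ := Fin.cons η fun _ => ρ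
  let L : EuclideanSpace ℝ (Fin (d + 1)) →ₗ[ℝ] EuclideanSpace ℝ (Fin (d + 1)) := Matrix.toEuclideanLin (Matrix.diagonal w)
  have hL (v : EuclideanSpace ℝ (Fin (d + 1))) (i : Fin (d + 1)) : L v i = w i * v i := by
    simp [L, Matrix.mulVec_diagonal]
  have hdet : LinearMap.det L = η * ρ ^ d := by
    simp only [L]
    rw [Matrix.toEuclideanLin_eq_toLin_orthonormal, LinearMap.det_toLin, Matrix.det_diagonal,
      Fin.prod_univ_succ]
    simp [w]
  have hsub : (fun v => (Real.cos φ - η) • e + v) '' (L '' Metric.ball 0 1) ⊆ K := by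
    rintro _ ⟨_, ⟨v, hv, rfl⟩, rfl⟩
    rw [mem_ball_zero_iff] at hv
    have hv2 : ‖v‖ ^ 2 < 1 := by nlinarith [norm_nonneg v]
    rw [EuclideanSpace.real_norm_sq_eq, Fin.sum_univ_succ] at hv2
    set b := ∑ i : Fin d, v i.succ ^ 2
    have hb : 0 ≤ b := Finset.sum_nonneg fun i _ => sq_nonneg _
    set z := (Real.cos φ - η) • e + L v with hz
    have hz0 : z 0 = Real.cos φ - η + η * v 0 := by
      simp [hz, hL, he, w]
    have hzs (i : Fin d) : z i.succ = ρ * v i.succ := by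
      simp [hz, hL, he, w]
    have hzn : ‖z‖ ^ 2 = (Real.cos φ - η + η * v 0) ^ 2 + ρ ^ 2 * b := by
      rw [EuclideanSpace.real_norm_sq_eq, Fin.sum_univ_succ, hz0]
      simp only [hzs, mul_pow, ← Finset.mul_sum]
      rfl
    have hv0 : v 0 ^ 2 < 1 := by linarith
    obtain ⟨hl, hr⟩ := abs_lt.1 ((sq_lt_one_iff_abs_lt_one _).1 hv0)
    have ha1 : Real.cos φ - 2 * η < Real.cos φ - η + η * v 0 := by nlinarith
    have ha2 : Real.cos φ - η + η * v 0 < Real.cos φ := by nlinarith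
    have hin : inner ℝ e z = z 0 := by
      rw [he, EuclideanSpace.inner_single_left]; simp
    have ha0 : 0 < z 0 := by rw [hz0]; linarith
    rw [← hz0] at ha1 ha2 hzn
    have hb1 : ρ ^ 2 * b ≤ ρ ^ 2 := mul_le_of_le_one_right (by positivity) (by nlinarith)
    rw [hK, mem_cone_cap]
    refine ⟨fun h => ?_, ?_, ?_⟩
    · change z = 0 at h
      rw [h] at ha0
      simp at ha0
    · refine (sq_lt_one_iff₀ (norm_nonneg _)).1 ?_
      rw [hzn]
      have h1 : z 0 ^ 2 < Real.cos φ ^ 2 := pow_lt_pow_left₀ ha2 ha0.le two_ne_zero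
      have h2 : ρ ^ 2 ≤ Real.sin φ ^ 2 := pow_le_pow_left₀ hρ0.le hρs 2
      linarith
    · change _ ≤ inner ℝ e z
      rw [hin]
      refine le_of_sq_le_sq ?_ ha0.le
      have h1 : (ρ * Real.cos φ) ^ 2 ≤ (Real.sin φ * z 0) ^ 2 := by
        rw [hρc]
        exact pow_le_pow_left₀ (mul_nonneg hsin.le (by linarith)) (by gcongr) 2
      rw [mul_pow, mul_pow] at h1
      rw [mul_pow, hzn]
      nlinarith [mul_le_mul_of_nonneg_left hb1 (sq_nonneg (Real.cos φ))]
  have hvol := surf_mul_volume_ball (measurableSet_cap φ x)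
  rw [← hK, surf_cap] at hvol
  have hle := measure_mono (μ := volume) hsub
  rw [image_add_left, measure_preimage_add, Measure.addHaar_image_linearMap, hdet,
    abs_of_nonneg (by positivity), ← hvol, ENNReal.mul_le_mul_iff_left hb0 hbt,
    ENNReal.ofReal_le_ofReal_iff (capArea_nonneg φ)] at hle
  exact hle

/-- A volume bound for the size of a spherical code. -/
theorem card_le_of_isCode {d n : ℕ} [NeZero d] {θ r : ℝ} (hr0 : 0 < r) (hr1 : r ≤ 1)
    (hr : 2 * r ^ 2 ≤ 1 - Real.cos θ) {x : Fin n → Sph d} (hx : IsCode θ x) :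
    (n : ℝ) ≤ (2 / r) ^ d := by
  set B := volume (Metric.ball (0 : EuclideanSpace ℝ (Fin d)) 1)
  have hb0 : B ≠ 0 := (Metric.measure_ball_pos _ _ one_pos).ne'
  have hbt : B ≠ ∞ := measure_ball_lt_top.ne
  -- Points of a code are at squared distance at least `2 - 2 * cos θ`, hence at distance at least
  -- `2 * r`.
  have hdisj : Pairwise (Function.onFun Disjoint fun i => Metric.ball (x i : EuclideanSpace ℝ (Fin d)) r) := by
    intro i j hij
    refine Metric.ball_disjoint_ball ?_
    rw [dist_eq_norm]
    refine le_of_sq_le_sq ?_ (norm_nonneg _)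
    have h1 : ‖(x i : EuclideanSpace ℝ (Fin d))‖ = 1 := by simp
    have h2 : ‖(x j : EuclideanSpace ℝ (Fin d))‖ = 1 := by simp
    rw [norm_sub_sq_real, h1, h2]
    have := hx i j hij
    nlinarith
  have hsub : (⋃ i, Metric.ball (x i : EuclideanSpace ℝ (Fin d)) r) ⊆ Metric.ball 0 2 := by
    refine iUnion_subset fun i => Metric.ball_subset_ball' ?_
    rw [dist_zero_right]
    have h1 : ‖(x i : EuclideanSpace ℝ (Fin d))‖ = 1 := by simp
    linarith
  have hle := measure_mono (μ := volume) hsub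
  rw [measure_iUnion hdisj fun i => measurableSet_ball, tsum_fintype] at hle
  simp only [Measure.addHaar_ball _ _ hr0.le, Measure.addHaar_ball _ _ zero_le_two] at hle
  rw [Finset.sum_const, Finset.card_univ, Fintype.card_fin, nsmul_eq_mul, ← mul_assoc,
    ENNReal.mul_le_mul_iff_left hb0 hbt, finrank_euclideanSpace_fin, ← ENNReal.ofReal_natCast,
    ← ENNReal.ofReal_mul (by positivity), ENNReal.ofReal_le_ofReal_iff (by positivity)] at hle
  rw [div_pow, le_div_iff₀ (by positivity)]
  exact hle

end SphericalCode

/-! ### Choosing the size of the code -/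

open MeasureTheory Set Filter Topology
open scoped ENNReal NNReal

namespace HardCore

/-- A nonnegative sequence whose weighted mean is at least `α` has a large term of index not much
smaller than `α`. -/
theorem exists_large_term {f : ℕ → ℝ} {M : ℕ} {α t : ℝ} (hf : ∀ k, 0 ≤ f k) (hα : 0 < α)
    (ht : 0 < t) (ht1 : t ≤ 1) (h1 : 1 ≤ ∑ k ∈ Finset.range (M + 1), f k)
    (h : α * ∑ k ∈ Finset.range (M + 1), f k ≤ ∑ k ∈ Finset.range (M + 1), k * f k) :
    ∃ n : ℕ, (1 - t) * α ≤ n ∧ t * α / (M + 1) ^ 2 ≤ f n := by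
  by_contra! hcon
  -- If every index from `(1 - t) * α` on had a small term, those indices would add less than `t *
  -- α` in total, which is too little for the mean to reach `α`.
  have key : ∀ k ∈ Finset.range (M + 1),
      (k : ℝ) * f k < (1 - t) * α * f k + t * α / (M + 1) := by
    intro k hk
    have hkM : (k : ℝ) ≤ M := by exact_mod_cast Nat.lt_succ_iff.1 (Finset.mem_range.1 hk)
    have hpos : 0 < t * α / (M + 1) := by positivity
    rcases le_or_gt ((1 - t) * α) k with hk' | hk'
    · have h2 := hcon k hk'
      have h3 : (k : ℝ) * f k ≤ M * (t * α / (M + 1) ^ 2) :=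
        mul_le_mul hkM h2.le (hf k) (by positivity)
      have h4 : M * (t * α / (M + 1) ^ 2) < t * α / (M + 1) := by
        rw [mul_div_assoc', div_lt_div_iff₀ (by positivity) (by positivity)]
        nlinarith [mul_pos (mul_pos ht hα) (show (0 : ℝ) < M + 1 by positivity)]
      have := mul_nonneg (mul_nonneg (sub_nonneg.2 ht1) hα.le) (hf k)
      linarith
    · have := mul_le_mul_of_nonneg_right hk'.le (hf k)
      linarith
  have hsum := Finset.sum_lt_sum_of_nonempty ⟨0, by simp⟩ key
  rw [Finset.sum_add_distrib, ← Finset.mul_sum, Finset.sum_const, Finset.card_range,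
    nsmul_eq_mul] at hsum
  have : ((M + 1 : ℕ) : ℝ) * (t * α / (M + 1)) = t * α := by
    push_cast
    field_simp
  have := mul_le_mul_of_nonneg_left h1 (mul_pos ht hα).le
  linarith

end HardCore

namespace SphericalCode

/-- The occupancy bound makes `α` a lower bound for the mean size, and `exists_large_term` extracts
one size. In the result `log σ + log d` is `-log l`, and the third term is the pigeonhole loss. -/
theorem exists_size {d : ℕ} (hd : 3 ≤ d) {θ : ℝ} (hθ : θ ∈ Ioo 0 (Real.pi / 2))
    (hsq : 0 < capArea d (q θ)) (hb : 1 ≤ capArea d θ / (d ^ 2 * capArea d (q θ))) {M : ℕ}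
    (hM : ∀ (n : ℕ) (x : Fin n → Sph d), IsCode θ x → n ≤ M) {α : ℝ} (hα : 0 < α)
    (hα' : α * (capArea d θ * ((1 - 2 / (d : ℝ))⁻¹ + 1 / d)) ≤
      1 + Real.log (capArea d θ / (d ^ 2 * capArea d (q θ)))) :
    ∃ n : ℕ, (1 - 1 / d) * α ≤ n ∧ 0 < codeProb d θ n ∧
      Real.log (capArea d (q θ)) + Real.log d + Real.log (α / (d * (M + 1) ^ 2)) / n ≤
        1 / n * Real.log (codeProb d θ n / n.factorial) := by
  have hd0 : (3 : ℝ) ≤ d := by exact_mod_cast hd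
  have : NeZero d := ⟨by omega⟩
  have := isProbabilityMeasure_surf d
  set s := capArea d θ
  set σ := capArea d (q θ)
  have hs : 0 < s := by
    by_contra! hs
    have : s / (d ^ 2 * σ) ≤ 0 := div_nonpos_of_nonpos_of_nonneg hs (by positivity)
    linarith
  -- Small enough that `κ = l * (2 * σ) = 2 / d` vanishes in the limit. With `b = s / (d ^ 2 * σ)`,
  -- the other error is `b / l = s / d`, negligible against `s`. Both choices cost only factors
  -- polynomial in `d`.
  obtain ⟨l, hl⟩ : ∃ l : ℝ≥0, (l : ℝ) = 1 / (d * σ) := ⟨⟨1 / (d * σ), by positivity⟩, rfl⟩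
  have hl0 : 0 < (l : ℝ) := by rw [hl]; positivity
  set Z := HardCore.part (surf d) (Compat (d := d) θ) l
  set Y := HardCore.points (surf d) (Compat (d := d) θ) l
  have hlE : (l : ℝ≥0∞) = ENNReal.ofReal l := (ENNReal.ofReal_coe_nnreal).symm
  have hsub (x : Sph d) : {u | ¬ Compat θ x u} ⊆ cap θ x := fun u hu => (not_le.1 hu).le
  have hocc : ENNReal.ofReal (1 + Real.log (s / (d ^ 2 * σ))) * Z ≤
      (ENNReal.ofReal (1 - 2 / d)⁻¹ * ENNReal.ofReal s +
        ENNReal.ofReal (s / (d ^ 2 * σ)) * (l : ℝ≥0∞)⁻¹) * Y := by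
    refine HardCore.log_mul_part_le_points (surf d) (measurableSet_compat θ)
      (fun u v h => h.symm) (by exact_mod_cast hl0.ne') (by positivity) ?_ hb (fun u => ?_)
      fun x T hT hTm => ?_
    · rw [div_lt_one (by linarith)]; linarith
    · rw [← surf_cap θ u]
      exact measure_mono fun x hx => hsub u fun h => hx h.symm
    · refine (mul_le_mul_right (prod_conflict_le hθ hT hTm) _).trans (le_of_eq ?_)
      rw [← mul_assoc, hlE, hl, ← ENNReal.ofReal_mul (by positivity)]
      congr 2
      change 1 / (d * σ) * (2 * σ) = _
      field_simp
  have hP (k : ℕ) : HardCore.codeMeas (surf d) (Compat (d := d) θ) k =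
      ENNReal.ofReal (codeProb d θ k) := by
    rw [codeProb_eq, ENNReal.ofReal_toReal]
    exact measure_ne_top _ _
  have hP0 (k : ℕ) (hk : k ∉ Finset.range (M + 1)) :
      HardCore.codeMeas (surf d) (Compat (d := d) θ) k = 0 := by
    rw [HardCore.codeMeas]
    convert measure_empty (μ := Measure.pi fun _ : Fin k => surf d)
    refine eq_empty_of_forall_notMem fun x hx => hk ?_
    exact Finset.mem_range.2 (Nat.lt_succ_iff.2 (hM k x hx))
  have hP1 (k : ℕ) : 0 ≤ codeProb d θ k := ENNReal.toReal_nonneg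
  let f : ℕ → ℝ := fun k => l ^ k / k.factorial * codeProb d θ k
  have hf (k : ℕ) : 0 ≤ f k := mul_nonneg (by positivity) (hP1 k)
  have hfE (k : ℕ) : HardCore.weight l k *
      HardCore.codeMeas (surf d) (Compat (d := d) θ) k = ENNReal.ofReal (f k) := by
    rw [hP, HardCore.weight, ← ENNReal.ofReal_coe_nnreal, ← ENNReal.ofReal_mul (by positivity)]
    simp [f]
  have hZ : Z = ENNReal.ofReal (∑ k ∈ Finset.range (M + 1), f k) := by
    rw [ENNReal.ofReal_sum_of_nonneg fun k _ => hf k]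
    simp only [Z, HardCore.part, ← hfE]
    exact tsum_eq_sum fun k hk => by rw [hP0 k hk, mul_zero]
  have hY : Y = ENNReal.ofReal (∑ k ∈ Finset.range (M + 1), k * f k) := by
    rw [ENNReal.ofReal_sum_of_nonneg fun k _ => mul_nonneg (by positivity) (hf k)]
    simp only [Y, HardCore.points, ENNReal.ofReal_mul (Nat.cast_nonneg _), ENNReal.ofReal_natCast,
      ← hfE]
    exact tsum_eq_sum fun k hk => by rw [hP0 k hk, mul_zero, mul_zero]
  have h1 : 1 ≤ ∑ k ∈ Finset.range (M + 1), f k := by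
    have := HardCore.one_le_part (surf d) (Compat (d := d) θ) l
    rw [← ENNReal.one_le_ofReal, ← hZ]
    exact this
  have hκ : 0 < 1 - 2 / (d : ℝ) := by
    rw [sub_pos, div_lt_one (by linarith)]; linarith
  have hlog : 0 ≤ Real.log (s / (d ^ 2 * σ)) := Real.log_nonneg hb
  set W := ∑ k ∈ Finset.range (M + 1), k * f k
  have hW : 0 ≤ W := Finset.sum_nonneg fun k _ => mul_nonneg (by positivity) (hf k)
  have hocc' : (1 + Real.log (s / (d ^ 2 * σ))) * ∑ k ∈ Finset.range (M + 1), f k ≤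
      s * ((1 - 2 / (d : ℝ))⁻¹ + 1 / d) * W := by
    rw [hZ, hY, hlE, ← ENNReal.ofReal_inv_of_pos hl0, ← ENNReal.ofReal_mul (by positivity),
      ← ENNReal.ofReal_mul (by positivity), ← ENNReal.ofReal_mul (by positivity),
      ← ENNReal.ofReal_add (by positivity) (by positivity), ← ENNReal.ofReal_mul (by positivity),
      ENNReal.ofReal_le_ofReal_iff (by positivity), hl] at hocc
    convert hocc using 2
    field_simp
  have hmean : α * ∑ k ∈ Finset.range (M + 1), f k ≤ W := by
    have hK : 0 < s * ((1 - 2 / (d : ℝ))⁻¹ + 1 / d) := by positivity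
    have := mul_le_mul_of_nonneg_right hα' (zero_le_one.trans h1)
    refine le_of_mul_le_mul_left ?_ hK
    linarith
  have ht1 : 1 / (d : ℝ) < 1 := by rw [div_lt_one (by linarith)]; linarith
  obtain ⟨n, hn, hfn⟩ := HardCore.exists_large_term hf hα (t := 1 / d) (by positivity) ht1.le
    h1 hmean
  have hn0 : 0 < (n : ℝ) := lt_of_lt_of_le (mul_pos (by linarith) hα) hn
  have hA : 0 < 1 / d * α / ((M : ℝ) + 1) ^ 2 := by positivity
  have hfn0 : 0 < f n := hA.trans_le hfn
  have hPn : 0 < codeProb d θ n := pos_of_mul_pos_right hfn0 (by positivity)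
  refine ⟨n, hn, hPn, ?_⟩
  have hle := Real.log_le_log hA hfn
  have e1 : f n = l ^ n * (codeProb d θ n / n.factorial) := by simp only [f]; ring
  rw [e1, Real.log_mul (by positivity) (by positivity), Real.log_pow, hl,
    one_div (_ * _), Real.log_inv, Real.log_mul (by positivity) (by positivity)] at hle
  have e2 : 1 / (d : ℝ) * α / ((M : ℝ) + 1) ^ 2 = α / (d * (M + 1) ^ 2) := by
    field_simp
  rw [e2] at hle
  rw [← sub_nonneg]
  have : 1 / (n : ℝ) * Real.log (codeProb d θ n / n.factorial) -
      (Real.log σ + Real.log d + Real.log (α / (d * (M + 1) ^ 2)) / n) =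
      1 / n * (n * -(Real.log d + Real.log σ) + Real.log (codeProb d θ n / n.factorial) -
        Real.log (α / (d * (M + 1) ^ 2))) := by
    field_simp
    ring
  rw [this]
  exact mul_nonneg (by positivity) (by linarith)

/-! ### Asymptotics in the dimension -/

theorem tendsto_log_div_natCast : Tendsto (fun d : ℕ => Real.log d / d) atTop (𝓝 0) := by
  have h := (Real.isLittleO_log_id_atTop.tendsto_div_nhds_zero).comp
    (tendsto_natCast_atTop_atTop (R := ℝ))
  exact h

theorem eventually_capArea_le {φ : ℝ} (hφ : φ ∈ Ioo 0 (Real.pi / 2)) :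
    ∀ᶠ d : ℕ in atTop, capArea d φ ≤ 2 * Real.sin φ ^ d := by
  have hc := cos_pos_of_mem hφ
  have hc1 := cos_lt_one_of_mem hφ
  have h : Tendsto (fun d : ℕ => (Real.cos φ ^ 2) ^ d) atTop (𝓝 0) :=
    tendsto_pow_atTop_nhds_zero_of_lt_one (by positivity) (by nlinarith)
  filter_upwards [h.eventually (eventually_le_nhds (show (0 : ℝ) < 1 / 2 by norm_num)),
    eventually_ge_atTop 1] with d hd hd1
  have : NeZero d := ⟨by omega⟩
  nlinarith [capArea_mul_le (d := d) hφ, capArea_nonneg (d := d) φ]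

theorem eventually_mul_capArea_le {φ : ℝ} (hφ : φ ∈ Ioo 0 (Real.pi / 2)) :
    ∀ᶠ d : ℕ in atTop, d * capArea d φ ≤ 1 := by
  have hc := cos_pos_of_mem hφ
  have hs := sin_pos_of_mem hφ
  have hs1 : Real.sin φ < 1 := by nlinarith [Real.sin_sq_add_cos_sq φ]
  have h : Tendsto (fun d : ℕ => (d : ℝ) * Real.sin φ ^ d) atTop (𝓝 0) :=
    tendsto_self_mul_const_pow_of_lt_one hs.le hs1
  filter_upwards [h.eventually (eventually_le_nhds (show (0 : ℝ) < 1 / 2 by norm_num)),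
    eventually_capArea_le hφ] with d hd hd1
  nlinarith [mul_le_mul_of_nonneg_left hd1 (Nat.cast_nonneg (α := ℝ) d)]

theorem tendsto_shrunk_sin (φ : ℝ) :
    Tendsto (fun d : ℕ => Real.sin φ - 2 * (1 / (d : ℝ)) * Real.tan φ) atTop
      (𝓝 (Real.sin φ)) := by
  have h := tendsto_one_div_atTop_nhds_zero_nat (𝕜 := ℝ)
  simpa using ((h.const_mul 2).mul_const (Real.tan φ)).const_sub (Real.sin φ)

theorem eventually_le_capArea {φ : ℝ} (hφ : φ ∈ Ioo 0 (Real.pi / 2)) :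
    ∀ᶠ d : ℕ in atTop, 1 / (d : ℝ) * (Real.sin φ - 2 * (1 / (d : ℝ)) * Real.tan φ) ^ d ≤
      capArea d φ := by
  have hc := cos_pos_of_mem hφ
  have hs := sin_pos_of_mem hφ
  have ht : 0 < Real.tan φ := by rw [Real.tan_eq_sin_div_cos]; positivity
  have h := tendsto_one_div_atTop_nhds_zero_nat (𝕜 := ℝ)
  filter_upwards [(tendsto_shrunk_sin φ).eventually (eventually_gt_nhds hs),
    h.eventually (eventually_lt_nhds (show (0 : ℝ) < Real.cos φ / 2 by positivity)),
    eventually_ge_atTop 1] with d hρ hη hd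
  obtain ⟨k, rfl⟩ : ∃ k, d = k + 1 := ⟨d - 1, by omega⟩
  have hη0 : 0 < 1 / ((k + 1 : ℕ) : ℝ) := by positivity
  refine le_trans ?_ (le_capArea hφ hη0 (by linarith))
  gcongr 1 / ((k + 1 : ℕ) : ℝ) * ?_
  -- `le_capArea` gives exponent `k` in dimension `k + 1`; the base is at most `1`, so the larger
  -- exponent only weakens the bound.
  refine pow_le_pow_of_le_one hρ.le ?_ (Nat.le_succ k)
  have : 0 < 2 * (1 / ((k + 1 : ℕ) : ℝ)) * Real.tan φ := by positivity
  linarith [Real.sin_le_one φ]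

/-- A lower bound for `log (s_d(θ) / (d ^ 2 * s_d(q(θ))))`. -/
noncomputable def logRatio (θ : ℝ) (d : ℕ) : ℝ :=
  d * Real.log ((Real.sin θ - 2 * (1 / (d : ℝ)) * Real.tan θ) / Real.sin (q θ)) -
    Real.log 2 - 3 * Real.log d

theorem tendsto_logRatio {θ : ℝ} (hθ : θ ∈ Ioo 0 (Real.pi / 2)) :
    Tendsto (fun d => logRatio θ d / d) atTop (𝓝 (c θ)) := by
  have hs := sin_pos_of_mem hθ
  have hsq := sin_pos_of_mem (q_mem hθ)
  have h1 := ((tendsto_shrunk_sin θ).div_const (Real.sin (q θ))).log (by positivity)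
  have h2 := (tendsto_one_div_atTop_nhds_zero_nat (𝕜 := ℝ)).const_mul (Real.log 2)
  have h3 := tendsto_log_div_natCast.const_mul 3
  have h := (h1.sub h2).sub h3
  simp only [mul_zero, sub_zero] at h
  refine h.congr' ?_
  filter_upwards [eventually_ge_atTop 1] with d hd
  have : (d : ℝ) ≠ 0 := by positivity
  rw [logRatio]
  field_simp

/-- The `3 * log d` in `logRatio` collects the `d ^ 2` of the denominator and the factor `1 / d` of
the lower cap bound; the `log 2` comes from the upper one. -/
theorem eventually_exp_logRatio_le {θ : ℝ} (hθ : θ ∈ Ioo 0 (Real.pi / 2)) :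
    ∀ᶠ d : ℕ in atTop, 0 < capArea d (q θ) ∧
      Real.exp (logRatio θ d) ≤ capArea d θ / (d ^ 2 * capArea d (q θ)) := by
  have hs := sin_pos_of_mem hθ
  have hsq := sin_pos_of_mem (q_mem hθ)
  filter_upwards [(tendsto_shrunk_sin θ).eventually (eventually_gt_nhds hs),
    (tendsto_shrunk_sin (q θ)).eventually (eventually_gt_nhds hsq),
    eventually_le_capArea hθ, eventually_le_capArea (q_mem hθ), eventually_capArea_le (q_mem hθ),
    eventually_ge_atTop 1] with d hρ hρq h1 h2 h3 hd
  have hd0 : (0 : ℝ) < d := by exact_mod_cast hd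
  set ρ := Real.sin θ - 2 * (1 / (d : ℝ)) * Real.tan θ
  have hpos : 0 < capArea d (q θ) := lt_of_lt_of_le (by positivity) h2
  refine ⟨hpos, ?_⟩
  have hlr : logRatio θ d = d * Real.log (ρ / Real.sin (q θ)) - Real.log 2 - 3 * Real.log d := rfl
  clear_value ρ
  have hexp : Real.exp (logRatio θ d) = 1 / d * ρ ^ d / (d ^ 2 * (2 * Real.sin (q θ) ^ d)) := by
    rw [hlr, Real.exp_sub, Real.exp_sub, Real.exp_log two_pos,
      show (3 : ℝ) * Real.log d = ((3 : ℕ) : ℝ) * Real.log d by norm_num,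
      Real.exp_nat_mul, Real.exp_nat_mul, Real.exp_log hd0, Real.exp_log (by positivity), div_pow]
    field_simp
  rw [hexp]
  gcongr
  exact capArea_nonneg θ

theorem exists_card_bound {θ : ℝ} (hθ : θ ∈ Ioo 0 (Real.pi / 2)) :
    ∃ A : ℝ, 1 < A ∧ ∀ d : ℕ, 1 ≤ d → ∃ M : ℕ, (M + 1 : ℝ) ≤ A ^ d ∧
      ∀ (n : ℕ) (x : Fin n → Sph d), IsCode θ x → n ≤ M := by
  have hc := cos_pos_of_mem hθ
  have hc1 := cos_lt_one_of_mem hθ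
  set r := (1 - Real.cos θ) / 2
  have hr0 : 0 < r := by simp only [r]; linarith
  have hr1 : r ≤ 1 := by simp only [r]; linarith
  have hr : 2 * r ^ 2 ≤ 1 - Real.cos θ := by simp only [r]; nlinarith
  have h2r : 1 ≤ 2 / r := by rw [one_le_div hr0]; linarith
  refine ⟨2 * (2 / r), by linarith, fun d hd => ⟨⌊(2 / r) ^ d⌋₊, ?_, fun n x hx => ?_⟩⟩
  · have h1 : (⌊(2 / r) ^ d⌋₊ : ℝ) ≤ (2 / r) ^ d := Nat.floor_le (by positivity)
    have h2 : 1 ≤ (2 / r) ^ d := one_le_pow₀ h2r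
    have h3 : (2 : ℝ) ≤ 2 ^ d := by simpa using pow_le_pow_right₀ (one_le_two (α := ℝ)) hd
    rw [mul_pow]
    nlinarith
  · have : NeZero d := ⟨by omega⟩
    exact Nat.le_floor (card_le_of_isCode hr0 hr1 hr hx)

/-- The lower bound for `n * s_d(θ) / d` that the hard-core model gives. -/
noncomputable def meanBound (θ : ℝ) (d : ℕ) : ℝ :=
  (1 - 1 / d) * ((logRatio θ d / d) / ((1 - 2 / (d : ℝ))⁻¹ + 1 / d))

theorem tendsto_meanBound {θ : ℝ} (hθ : θ ∈ Ioo 0 (Real.pi / 2)) :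
    Tendsto (meanBound θ) atTop (𝓝 (c θ)) := by
  have h := tendsto_one_div_atTop_nhds_zero_nat (𝕜 := ℝ)
  have h2 : Tendsto (fun d : ℕ => (1 - 2 / (d : ℝ))⁻¹) atTop (𝓝 1) := by
    have := ((tendsto_const_div_atTop_nhds_zero_nat (2 : ℝ)).const_sub 1).inv₀ (by norm_num)
    simpa using this
  have := (h.const_sub 1).mul ((tendsto_logRatio hθ).div (h2.add h) (by norm_num))
  simp only [sub_zero, add_zero, div_one, one_mul] at this
  exact this

theorem exists_size_eventually {θ : ℝ} (hθ : θ ∈ Ioo 0 (Real.pi / 2)) :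
    ∃ A : ℝ, 1 < A ∧ ∀ᶠ d : ℕ in atTop, ∃ n : ℕ,
      meanBound θ d * (d / capArea d θ) ≤ n ∧ 0 < codeProb d θ n ∧
      Real.log (capArea d (q θ)) +
          -((Real.log d / d + 2 * Real.log A) / (meanBound θ d * d)) ≤
        1 / n * Real.log (codeProb d θ n / n.factorial) := by
  obtain ⟨A, hA, hcard⟩ := exists_card_bound hθ
  have hcpos := c_pos hθ
  refine ⟨A, hA, ?_⟩
  have hmean_top : Tendsto (fun d : ℕ => meanBound θ d * d) atTop atTop :=
    (tendsto_meanBound hθ).pos_mul_atTop hcpos tendsto_natCast_atTop_atTop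
  filter_upwards [eventually_exp_logRatio_le hθ, eventually_mul_capArea_le hθ,
    (tendsto_logRatio hθ).eventually (eventually_gt_nhds hcpos),
    (tendsto_meanBound hθ).eventually (eventually_gt_nhds hcpos),
    hmean_top.eventually (eventually_ge_atTop 1), eventually_ge_atTop 3]
    with d ⟨hσ, hexp⟩ hsmall hβ hu hu1 hd
  have hd3 : (3 : ℝ) ≤ d := by exact_mod_cast hd
  have hd0 : (0 : ℝ) < d := by linarith
  set s := capArea d θ
  set σ := capArea d (q θ)
  have hβ0 : 0 < logRatio θ d := by
    have := mul_pos hβ hd0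
    rwa [div_mul_cancel₀ _ hd0.ne'] at this
  have hb : 1 ≤ s / (d ^ 2 * σ) := (Real.one_le_exp hβ0.le).trans hexp
  have hs : 0 < s := by
    by_contra! hs
    have : s / (d ^ 2 * σ) ≤ 0 := div_nonpos_of_nonpos_of_nonneg hs (by positivity)
    linarith
  have hlog : logRatio θ d ≤ Real.log (s / (d ^ 2 * σ)) := by
    rwa [Real.le_log_iff_exp_le (by linarith)]
  have hκ : 0 < 1 - 2 / (d : ℝ) := by
    rw [sub_pos, div_lt_one hd0]; linarith
  set K := (1 - 2 / (d : ℝ))⁻¹ + 1 / d with hK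
  have hK0 : 0 < K := by positivity
  -- The summand `1` beside the logarithm in the occupancy bound is dropped here.
  set α := logRatio θ d / (s * K) with hα
  have hα0 : 0 < α := by positivity
  obtain ⟨M, hMA, hM⟩ := hcard d (by omega)
  obtain ⟨n, hn, hP, hlogP⟩ := exists_size hd hθ hσ hb hM hα0 (by
    rw [hα, div_mul_cancel₀ _ (by positivity)]
    linarith)
  have hmean : (1 - 1 / d) * α = meanBound θ d * (d / s) := by
    rw [meanBound, ← hK, hα]
    field_simp
  rw [hmean] at hn
  refine ⟨n, hn, hP, le_trans ?_ hlogP⟩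
  have hds : (d : ℝ) ≤ 1 / s := by rw [le_div_iff₀ hs]; exact hsmall
  -- As `d * s ≤ 1`, the size is at least of order `d ^ 2`, whereas the logarithm of the pigeonhole
  -- loss is only linear in `d`. After division by `n` the loss therefore vanishes.
  have hnd : meanBound θ d * d * d ≤ n := by
    refine le_trans ?_ hn
    rw [mul_assoc, ← mul_one_div (d : ℝ) s]
    gcongr
  have hn0 : 0 < (n : ℝ) := lt_of_lt_of_le (by positivity) hnd
  have hα1 : 1 ≤ α := by
    have h1 : meanBound θ d * (d / s) ≤ α := by
      rw [← hmean]
      exact mul_le_of_le_one_left hα0.le (by simp)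
    have h2 : meanBound θ d * d * d ≤ meanBound θ d * (d / s) := by
      rw [mul_assoc, ← mul_one_div (d : ℝ) s]
      gcongr
    nlinarith
  have hlogd : 0 ≤ Real.log d := Real.log_nonneg (by linarith)
  have hlogA : 0 < Real.log A := Real.log_pos hA
  have hbound : -(Real.log d + 2 * (d * Real.log A)) ≤ Real.log (α / (d * (M + 1) ^ 2)) := by
    rw [Real.log_div (by positivity) (by positivity), Real.log_mul (by positivity) (by positivity),
      Real.log_pow]
    have h1 := Real.log_nonneg hα1
    have h2 := Real.log_le_log (by positivity) hMA
    rw [Real.log_pow] at h2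
    push_cast
    linarith
  have hfin : -((Real.log d / d + 2 * Real.log A) / (meanBound θ d * d)) ≤
      Real.log (α / (d * (M + 1) ^ 2)) / n := by
    have e : (Real.log d / d + 2 * Real.log A) / (meanBound θ d * d) =
        (Real.log d + 2 * (d * Real.log A)) / (meanBound θ d * d * d) := by
      field_simp
    rw [e]
    calc -((Real.log d + 2 * (d * Real.log A)) / (meanBound θ d * d * d))
        ≤ -((Real.log d + 2 * (d * Real.log A)) / n) := by gcongr
      _ = -(Real.log d + 2 * (d * Real.log A)) / n := by ring
      _ ≤ _ := by gcongr
  -- The extra `log d` from the activity is nonnegative and is discarded.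
  linarith

end SphericalCode

theorem theorem3 (θ : ℝ) (hθ : θ ∈ Set.Ioo 0 (Real.pi / 2)) :
    ∃ (n : ℕ → ℕ) (ε δ : ℕ → ℝ),
      Filter.Tendsto ε Filter.atTop (nhds 0) ∧ Filter.Tendsto δ Filter.atTop (nhds 0) ∧
      ∀ᶠ d : ℕ in Filter.atTop,
        (1 + ε d) * (SphericalCode.c θ * (d : ℝ) / SphericalCode.capArea d θ) ≤ (n d : ℝ) ∧
        0 < SphericalCode.codeProb d θ (n d) ∧
        Real.log (SphericalCode.capArea d (SphericalCode.q θ)) + δ d ≤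
          1 / (n d : ℝ) *
            Real.log (SphericalCode.codeProb d θ (n d) / (Nat.factorial (n d) : ℝ)) := by
  classical
  obtain ⟨A, hA, h⟩ := SphericalCode.exists_size_eventually hθ
  have hc := SphericalCode.c_pos hθ
  have hmean := SphericalCode.tendsto_meanBound hθ
  obtain ⟨n, hn⟩ := h.choice
  -- This `ε` makes `(1 + ε d) * c θ` equal to `meanBound θ d`.
  refine ⟨n, fun d => SphericalCode.meanBound θ d / SphericalCode.c θ - 1,
    fun d => -((Real.log d / d + 2 * Real.log A) / (SphericalCode.meanBound θ d * d)), ?_, ?_, ?_⟩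
  · have := (hmean.div_const (SphericalCode.c θ)).sub_const 1
    rwa [div_self hc.ne', sub_self] at this
  · have := ((SphericalCode.tendsto_log_div_natCast.add_const (2 * Real.log A)).div_atTop
      (hmean.pos_mul_atTop hc tendsto_natCast_atTop_atTop)).neg
    rwa [neg_zero] at this
  · filter_upwards [hn] with d ⟨h1, h2, h3⟩
    refine ⟨le_trans (le_of_eq ?_) h1, h2, h3⟩
    field_simp
    ring
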